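/- **Setting.** All tensors and matrices are real. For $\mathbf A=[\mathbf a_1\dots\mathbf a_R]\in\mathbb R^{I\times R}$, $\mathbf B\in\mathbb R^{J\times R}$, $\mathbf C\in\mathbb R^{K\times R}$ let $[\mathbf A,\mathbf B,\mathbf C]_R$ be the $I\times J\times K$ tensor with entries $t_{ijk}=\sum_{r=1}^R a_{ir}b_{jr}c_{kr}$. The rank $r_{\mathcal T}$ is the least number of rank-one tensors (outer products of nonzero vectors) with sum $\mathcal T$; a decomposition $\mathcal T=[\mathbf A,\mathbf B,\mathbf C]_R$ into $R=r_{\mathcal T}$ rank-one terms is a CPD. The CPD is unique if any two CPDs agree up to permutation of the rank-one terms and scaling of the vectors inside each term that leaves the term unchanged. The $k$-rank $k_{\mathbf M}$ is the largest $k$ such that every $k$ columns of $\mathbf M$ are linearly independent, $\odot$ is the Khatri–Rao (columnwise Kronecker) product, $\mathbf F^{(n)}=\mathbf F\odot\dots\odot\mathbf F$ ($n$ factors), and $C_n^k=\binom nk$. For $\mathcal T\in\mathbb R^{I\times J\times K}$, $m\ge1$, $l\ge 0$, the matrix $\mathbf R_{m,l}(\mathcal T)\in\mathbb R^{I^{m+l}J^{m+l}\times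 K^{m+l}}$ has, in the row indexed by $(i_1,\dots,i_{m+l},j_1,\dots,j_{m+l})$ and the column indexed by $(k_1,\dots,k_{m+l})$ (lexicographic order), the entry $$\frac1{m!\,(m+l)!}\sum_{(s_1,\dots,s_{m+l})}\det\big[t_{i_pj_qs_q}\big]_{p,q=1}^m\ \prod_{p=1}^l t_{i_{m+p}j_{m+p}s_{m+p}},$$ the sum being over all $(m+l)!$ rearrangements of $(k_1,\dots,k_{m+l})$, counted with multiplicity. $S^{n}(\mathbb R^{K^{n}})\subset\mathbb R^{K^{n}}$ is the span of the vectors $\mathbf x\otimes\dots\otimes\mathbf x$ ($n$ factors), $\mathbf x\in\mathbb R^K$. **Theorem.** Let $\mathcal T=[\mathbf A,\mathbf B,\mathbf C]_R$, $r_{\mathbf C}=K\le R$, $K\ge 2$, $m=R-K+2$, $l\ge0$. Assume that (i) $k_{\mathbf C}=K$; (ii) $\mathbf A\odot\mathbf B$ has full column rank; (iii) $\dim E=C_R^{K-1}$, where $E:=\ker(\mathbf R_{m,l}(\mathcal T))\cap S^{m+l}(\mathbb R^{K^{m+l}})$. Write $N=C_R^{K-1}$. Then: 1. $r_{\mathcal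 T}=R$ and the CPD of $\mathcal T$ is unique. 2. There is a matrix $\mathbf F\in\mathbb R^{K\times N}$ such that $(*)$ every column of $\mathbf F$ is orthogonal to exactly $K-1$ columns of $\mathbf C$, and any vector orthogonal to exactly $K-1$ columns of $\mathbf C$ is proportional to a column of $\mathbf F$. For every such $\mathbf F$ one has $k_{\mathbf F}\ge 2$, $\mathbf F^{(m+l-1)}$ has full column rank, and $E=\operatorname{range}(\mathbf F^{(m+l)})$. Moreover, for every matrix $\mathbf W$ whose $N$ columns form a basis of $E$ there is a unique nonsingular $\mathbf M\in\mathbb R^{N\times N}$ with $\mathbf W=\mathbf F^{(m+l)}\mathbf M^T$. 3. The CPD can be found algebraically, that is, the following procedure, whatever choices are made in its steps, never gets stuck and always outputs a CPD of $\mathcal T$; the matrix $\mathbf F$ found in step (c) always satisfies $(*)$. (a) Find $\mathbf W\in\mathbb R^{K^{m+l}\times N}$ whose columns form a basis of $E$, and reshape it into a $K\times K^{m+l-1}\times N$ tensor $\mathcal W$. (b) For $\mathbf u\in\mathbb R^K$ let $\mathbf W_{\mathbf u}\in\mathbb R^{K^{m+l-1}\times N}$ be the combination of the $K$ horizontal slices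 of $\mathcal W$ with coefficients $\mathbf u$. Find $\mathbf u,\mathbf v$ for which $\mathbf W_{\mathbf v}$ has full column rank and the pencil has $N$ distinct real generalized eigenvalues, and compute the GEVD $\mathbf W_{\mathbf u}\mathbf y_j=\mu_j\mathbf W_{\mathbf v}\mathbf y_j$, $\mathbf y_j\ne\mathbf 0$, $j=1,\dots,N$. (This is possible for all $(\mathbf u,\mathbf v)$ outside the zero set of some nonzero polynomial.) (c) For each $j$ reshape $\mathbf W\mathbf y_j$ into a $K\times K^{m+l-1}$ matrix and let $\mathbf f_j$ be a nonzero vector in its column space; $\mathbf F=[\mathbf f_1\dots\mathbf f_N]$. (d) Find $R$ different sets of $C_{R-1}^{K-2}$ columns of $\mathbf F$ for which there is a nonzero vector orthogonal to all columns in the set, and take one such vector for each set as the columns $\mathbf c'_1,\dots,\mathbf c'_R$ of $\mathbf C'$. (e) For each $r$ choose a nonzero vector $\mathbf a^0_r$ (respectively $\mathbf b^0_r$) in the intersection of the column (respectively row) spaces of the matrices $\big(\sum_k t_{ijk}f_{kj'}\big)_{i,j}\in\mathbb R^{I\times J}$ over all $j'$ with $\mathbf f_{j'}^T\mathbf c'_r\ne0$.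 (f) Solve the linear system $\mathcal T=\sum_r x_r\,\mathbf a^0_r\circ\mathbf b^0_r\circ\mathbf c'_r$ for $x_1,\dots,x_R$, and output $[x_1\mathbf a^0_1\dots x_R\mathbf a^0_R]$, $[\mathbf b^0_1\dots\mathbf b^0_R]$, $\mathbf C'$. -/

import Mathlib

open scoped Matrix

noncomputable section

namespace CPD

/-- Real third-order tensors `𝒯 = (t_{ijk})` of size `I × J × K`. -/
abbrev Tensor3 (I J K : ℕ) : Type := Fin I → Fin J → Fin K → ℝ

/-- `[A, B, C]_R`: the tensor with entries `t_{ijk} = ∑_r a_{ir} b_{jr} c_{kr}`. -/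
def polyadic {I J K R : ℕ} (A : Matrix (Fin I) (Fin R) ℝ) (B : Matrix (Fin J) (Fin R) ℝ)
    (C : Matrix (Fin K) (Fin R) ℝ) : Tensor3 I J K :=
  fun i j k => ∑ r, A i r * B j r * C k r

/-- `T = [A, B, C]_R` is a polyadic decomposition: a sum of `R` rank-one tensors, that is, of `R`
outer products of nonzero vectors. -/
def IsPD {I J K R : ℕ} (T : Tensor3 I J K) (A : Matrix (Fin I) (Fin R) ℝ)
    (B : Matrix (Fin J) (Fin R) ℝ) (C : Matrix (Fin K) (Fin R) ℝ) : Prop :=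
  T = polyadic A B C ∧ ∀ r, A.col r ≠ 0 ∧ B.col r ≠ 0 ∧ C.col r ≠ 0

/-- The rank of `T`: the least number of rank-one terms in a polyadic decomposition of `T`. -/
def tensorRank {I J K : ℕ} (T : Tensor3 I J K) : ℕ :=
  sInf {R : ℕ | ∃ (A : Matrix (Fin I) (Fin R) ℝ) (B : Matrix (Fin J) (Fin R) ℝ)
    (C : Matrix (Fin K) (Fin R) ℝ), IsPD T A B C}

/-- A canonical polyadic decomposition: a polyadic decomposition with the least possible number
of terms. -/
def IsCPD {I J K R : ℕ} (T : Tensor3 I J K) (A : Matrix (Fin I) (Fin R) ℝ)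
    (B : Matrix (Fin J) (Fin R) ℝ) (C : Matrix (Fin K) (Fin R) ℝ) : Prop :=
  IsPD T A B C ∧ R = tensorRank T

/-- The CPD of `T` is unique: any two CPDs agree up to a permutation of the rank-one terms and
a scaling of the vectors within each term that does not change the term. -/
def CPDUnique {I J K : ℕ} (T : Tensor3 I J K) : Prop :=
  ∀ (R : ℕ) (A A' : Matrix (Fin I) (Fin R) ℝ) (B B' : Matrix (Fin J) (Fin R) ℝ)
    (C C' : Matrix (Fin K) (Fin R) ℝ), IsCPD T A B C → IsCPD T A' B' C' →
    ∃ (σ : Equiv.Perm (Fin R)) (α β γ : Fin R → ℝ), ∀ r,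
      α r * β r * γ r = 1 ∧ A'.col r = α r • A.col (σ r) ∧ B'.col r = β r • B.col (σ r) ∧
        C'.col r = γ r • C.col (σ r)

/-- Full column rank: the columns are linearly independent. -/
def FullColRank {ι : Type*} {R : ℕ} (M : Matrix ι (Fin R) ℝ) : Prop :=
  LinearIndependent ℝ M.col

/-- The `k`-rank of a matrix: the largest number `k` (not exceeding the number of columns) such
that every set of `k` columns is linearly independent. -/
def kRank {ι : Type*} {R : ℕ} (M : Matrix ι (Fin R) ℝ) : ℕ :=
  sSup {k : ℕ | k ≤ R ∧ ∀ s : Finset (Fin R), s.card = k →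
    LinearIndependent ℝ (fun r : s => M.col r)}

/-- The Khatri-Rao product `A ⊙ B`, whose columns are the Kronecker products `a_r ⊗ b_r`; its
rows are indexed by pairs. -/
def khatriRao {ι κ : Type*} {R : ℕ} (A : Matrix ι (Fin R) ℝ) (B : Matrix κ (Fin R) ℝ) :
    Matrix (ι × κ) (Fin R) ℝ :=
  Matrix.of fun p r => A p.1 r * B p.2 r

/-- The Khatri-Rao power `F^{(n)} = F ⊙ ⋯ ⊙ F` (`n` factors), whose rows are indexed by
multi-indices `(k_1, …, k_n)`. -/
def khatriRaoPow {K N : ℕ} (F : Matrix (Fin K) (Fin N) ℝ) (n : ℕ) :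
    Matrix (Fin n → Fin K) (Fin N) ℝ :=
  Matrix.of fun k j => ∏ p, F (k p) j

/-- The span of the vectors `x ⊗ ⋯ ⊗ x` (`n` factors), `x ∈ ℝ^K`: the vectorized symmetric
`K × ⋯ × K` tensors of order `n`. Coordinates are indexed by multi-indices. -/
def symSubspace (K n : ℕ) : Submodule ℝ ((Fin n → Fin K) → ℝ) :=
  Submodule.span ℝ (Set.range fun (x : Fin K → ℝ) (k : Fin n → Fin K) => ∏ p, x (k p))

/-- The matrix `R_{m,l}(T)`. Rows are indexed by `((i_1, …, i_{m+l}), (j_1, …, j_{m+l}))`, columns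
by `(k_1, …, k_{m+l})`. The sum is over all `(m+l)!` rearrangements `s` of `(k_1, …, k_{m+l})`,
counted with multiplicity. -/
def RMatrix {I J K : ℕ} (m l : ℕ) (T : Tensor3 I J K) :
    Matrix ((Fin (m + l) → Fin I) × (Fin (m + l) → Fin J)) (Fin (m + l) → Fin K) ℝ :=
  Matrix.of fun ij k =>
    (1 / ((m.factorial : ℝ) * ((m + l).factorial : ℝ))) *
      ∑ σ : Equiv.Perm (Fin (m + l)),
        (Matrix.of fun p q : Fin m =>
            T (ij.1 (Fin.castAdd l p)) (ij.2 (Fin.castAdd l q)) (k (σ (Fin.castAdd l q)))).det *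
          ∏ p : Fin l,
            T (ij.1 (Fin.natAdd m p)) (ij.2 (Fin.natAdd m p)) (k (σ (Fin.natAdd m p)))

/-- The space `ker R_{m,l}(T) ∩ S^{m+l}`. -/
def symKer {I J K : ℕ} (m l : ℕ) (T : Tensor3 I J K) :
    Submodule ℝ ((Fin (m + l) → Fin K) → ℝ) :=
  LinearMap.ker (RMatrix m l T).mulVecLin ⊓ symSubspace K (m + l)

/-- `F` is a `K × binom(R, K-1)` matrix such that every column of `F` is orthogonal to exactly
`K - 1` columns of `C`, and any vector that is orthogonal to exactly `K - 1` columns of `C` is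
proportional to a column of `F`. -/
def IsNormalMatrix {K R : ℕ} (C : Matrix (Fin K) (Fin R) ℝ)
    (F : Matrix (Fin K) (Fin (R.choose (K - 1))) ℝ) : Prop :=
  (∀ j, {r | F.col j ⬝ᵥ C.col r = 0}.ncard = K - 1) ∧
    ∀ x : Fin K → ℝ, {r | x ⬝ᵥ C.col r = 0}.ncard = K - 1 → ∃ (j : _) (t : ℝ), x = t • F.col j

/-! ### The steps of the algebraic algorithm -/

/-- The columns of `W` form a basis of the subspace `E`. -/
def IsBasisMatrix {ι : Type*} {N : ℕ} (E : Submodule ℝ (ι → ℝ)) (W : Matrix ι (Fin N) ℝ) : Prop :=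
  LinearIndependent ℝ W.col ∧ Submodule.span ℝ (Set.range W.col) = E

/-- Reshape a vector of length `K^n` into a `K × K^{n-1}` matrix: the entry in row `k` and column
`(κ_1, …, κ_{n-1})` is the `(k, κ_1, …, κ_{n-1})`-th coordinate. -/
def reshapeVec {K n : ℕ} (w : (Fin n → Fin K) → ℝ) : Matrix (Fin K) (Fin (n - 1) → Fin K) ℝ :=
  Matrix.of fun k κ => w fun p =>
    if hp : (p : ℕ) = 0 then k else κ ⟨(p : ℕ) - 1, by have := p.isLt; omega⟩

/-- The `K^n × N` matrix `W` is reshaped into a `K × K^{n-1} × N` tensor `𝒲`; this is the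
combination, with coefficients `u`, of the `K` horizontal slices of `𝒲`, each of which is
a `K^{n-1} × N` matrix. -/
def sliceComb {K n N : ℕ} (W : Matrix (Fin n → Fin K) (Fin N) ℝ) (u : Fin K → ℝ) :
    Matrix (Fin (n - 1) → Fin K) (Fin N) ℝ :=
  Matrix.of fun κ j => ∑ k, u k * reshapeVec (W.col j) k κ

/-- A generalized eigenvalue decomposition of the pencil formed by two combinations of slices of
`𝒲`: the second matrix has full column rank, and the columns of `Y` are generalized
eigenvectors with `N` distinct real generalized eigenvalues `μ_1, …, μ_N`. -/
def IsGEVD {K n N : ℕ} (W : Matrix (Fin n → Fin K) (Fin N) ℝ) (u v : Fin K → ℝ)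
    (Y : Matrix (Fin N) (Fin N) ℝ) (μ : Fin N → ℝ) : Prop :=
  FullColRank (sliceComb W v) ∧ Function.Injective μ ∧
    ∀ j, Y.col j ≠ 0 ∧ sliceComb W u *ᵥ Y.col j = μ j • (sliceComb W v *ᵥ Y.col j)

/-- The `j`-th column of `F` is a nonzero vector in the column space of the `K × K^{n-1}` matrix
obtained by reshaping the vector `W y_j`. -/
def IsReadOff {K n N : ℕ} (W : Matrix (Fin n → Fin K) (Fin N) ℝ) (Y : Matrix (Fin N) (Fin N) ℝ)
    (F : Matrix (Fin K) (Fin N) ℝ) : Prop :=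
  ∀ j, F.col j ≠ 0 ∧ F.col j ∈ LinearMap.range (reshapeVec (W *ᵥ Y.col j)).mulVecLin

/-- Computation of the third factor matrix from `F`: the `R` columns of `C'` are nonzero vectors
in the left null spaces of `R` different submatrices of `F`, each consisting of
`binom(R-1, K-2)` columns of `F`. -/
def IsThirdFactorFrom {K R N : ℕ} (F : Matrix (Fin K) (Fin N) ℝ) (C' : Matrix (Fin K) (Fin R) ℝ) :
    Prop :=
  ∃ s : Fin R → Finset (Fin N), Function.Injective s ∧ ∀ r,
    (s r).card = (R - 1).choose (K - 2) ∧ C'.col r ≠ 0 ∧ ∀ j ∈ s r, C'.col r ⬝ᵥ F.col j = 0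

/-- The `I × J` matrix obtained by contracting the third mode of `T` with `f`. -/
def contract {I J K : ℕ} (T : Tensor3 I J K) (f : Fin K → ℝ) : Matrix (Fin I) (Fin J) ℝ :=
  Matrix.of fun i j => ∑ k, T i j k * f k

/-- Computation of the first two factor matrices up to scaling: the `r`-th column of `A₀`
(of `B₀`) is a nonzero vector in the intersection of the column (row) spaces of those contractions
`T f_j` for which `f_j` is not orthogonal to the `r`-th column of `C'`. -/
def AreDirections {I J K R N : ℕ} (T : Tensor3 I J K) (F : Matrix (Fin K) (Fin N) ℝ)
    (C' : Matrix (Fin K) (Fin R) ℝ) (A₀ : Matrix (Fin I) (Fin R) ℝ)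
    (B₀ : Matrix (Fin J) (Fin R) ℝ) : Prop :=
  ∀ r, A₀.col r ≠ 0 ∧ B₀.col r ≠ 0 ∧ ∀ j, C'.col r ⬝ᵥ F.col j ≠ 0 →
    A₀.col r ∈ LinearMap.range (contract T (F.col j)).mulVecLin ∧
      B₀.col r ∈ LinearMap.range (contract T (F.col j))ᵀ.mulVecLin

/-- The CPD of `T` (with `R` terms) is found by the following algebraic algorithm, with parameters
`m` and `l`, whatever the choices made on the way: no step ever gets stuck, and
every possible output is a CPD of `T`.

1. Find a `K^{m+l} × binom(R, K-1)` matrix `W` whose columns form a basis of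
   `ker R_{m,l}(T) ∩ S^{m+l}`.
2. Reshape `W` into a `K × K^{m+l-1} × binom(R, K-1)` tensor `𝒲` and compute a GEVD of a pencil
   formed by two combinations of its horizontal slices; this is possible for a generic pair of
   coefficient vectors `(u, v)`, namely outside the zero set of a nonzero polynomial.
3. Read off `F` from the generalized eigenvectors.
4. Find the third factor matrix from null spaces of submatrices of `F`.
5. Find the columns of the first two factor matrices up to scaling by intersecting column spaces.
6. Find the scaling factors from a system of linear equations. -/
def FoundAlgebraically {I J K : ℕ} (T : Tensor3 I J K) (R m l : ℕ) : Prop :=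
  (∃ W : Matrix (Fin (m + l) → Fin K) (Fin (R.choose (K - 1))) ℝ,
      IsBasisMatrix (symKer m l T) W) ∧
  ∀ W : Matrix (Fin (m + l) → Fin K) (Fin (R.choose (K - 1))) ℝ,
    IsBasisMatrix (symKer m l T) W →
    (∃ P : MvPolynomial (Fin K ⊕ Fin K) ℝ, P ≠ 0 ∧ ∀ u v : Fin K → ℝ,
      MvPolynomial.eval (Sum.elim u v) P ≠ 0 → ∃ Y μ, IsGEVD W u v Y μ) ∧
    ∀ u v Y μ, IsGEVD W u v Y μ →
      (∃ F, IsReadOff W Y F) ∧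
      ∀ F, IsReadOff W Y F →
        (∃ C' : Matrix (Fin K) (Fin R) ℝ, IsThirdFactorFrom F C') ∧
        ∀ C' : Matrix (Fin K) (Fin R) ℝ, IsThirdFactorFrom F C' →
          (∃ A₀ B₀, AreDirections T F C' A₀ B₀) ∧
          ∀ A₀ B₀, AreDirections T F C' A₀ B₀ →
            (∃ x : Fin R → ℝ, T = polyadic (A₀ * Matrix.diagonal x) B₀ C') ∧
            ∀ x : Fin R → ℝ, T = polyadic (A₀ * Matrix.diagonal x) B₀ C' →
              IsCPD T (A₀ * Matrix.diagonal x) B₀ C'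

end CPD

end

namespace CPD

open Finset Module

/-! ### Linear algebra -/

/-! Write `T f` for the contraction of the third mode with `f`; it equals `∑ r, (f · c_r) a_r b_rᵀ`.
Applied to a symmetric power `f ⊗ ⋯ ⊗ f`, the matrix `R_{m,l}(T)` gives, up to a factor, the `m × m`
minors of `T f` times products of its entries. Hence the power lies in `E` whenever `T f` has rank
less than `m`.

A column `f_j` of `F` kills `K - 1` of the `R` terms, so `T f_j` is a sum of `m - 1` rank-one
matrices and the power of `f_j` lies in `E`. These `N` powers are independent because the columns of
`C` are in general position (`IsNormalMatrix.fullColRank_khatriRaoPow`), and `dim E = N` makes them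
a basis. Since the powers of order `m + l - 1` are independent too, the only nonzero symmetric
powers in `E` come from multiples of the `f_j`. So every `f` with `rank (T f) < m` lies on one of
finitely many lines; this is `LowRankIn`, from which rank and uniqueness follow.

Finitely many lines do not cover a real space of dimension at least two, yet `K - 2` vectors in
`ℝ^K` always have such a space orthogonal to them. So any `m` columns of `A`, and of `B`, are
independent, and no decomposition has fewer than `R` terms. In particular `T f_j` has rank exactly
`m - 1`. This is intrinsic to `T`, so in any decomposition with `R` terms the `f_j` enumerate the
`(K-1)`-subsets of the third factor's columns to which they are orthogonal.

Recovering `C` from `F` is a counting problem: a nonzero vector orthogonal to `binom(R-1, K-2)`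
columns of `F` is a multiple of a column of `C` (`card_filter_powersetCard_le`,
`exists_smul_col_of_card_le`). The directions of `a_r`, `b_r` come from intersecting ranges of the
`T f_j`, and the scalings from independence of the columns of `A ⊙ B`. The same lemmas prove
uniqueness and the correctness of steps (d) to (f): a second decomposition satisfies the constraints
imposed there. The GEVD works because the slices of `W` are `F^{(m+l-1)} diag(f_i · u) Mᵀ`. -/

theorem exists_dotProduct_eq {ι : Type*} {n : ℕ} {v : ι → Fin n → ℝ} {s : Finset ι}
    (hv : LinearIndepOn ℝ v (s : Set ι)) (d : ι → ℝ) : ∃ y : Fin n → ℝ, ∀ i ∈ s, y ⬝ᵥ v i = d i := by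
  obtain ⟨g, hg⟩ := (((Basis.span hv).constr ℝ) (fun i => d i)).exists_extend
  refine ⟨fun j => g (Pi.single j 1), fun i hi => ?_⟩
  have h1 : g (v i) = d i := by
    have h2 := LinearMap.congr_fun hg ((Basis.span hv) ⟨i, hi⟩)
    rw [Basis.constr_basis] at h2
    rw [← h2, LinearMap.comp_apply]
    exact congrArg g (congrArg Subtype.val (Basis.span_apply hv ⟨i, hi⟩)).symm
  rw [← h1, ← LinearMap.sum_single_apply (fun _ : Fin n => ℝ) (v i), map_sum]
  simp only [dotProduct]
  refine Finset.sum_congr rfl fun j _ => ?_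
  have : (Pi.single j (v i j) : Fin n → ℝ) = v i j • Pi.single j 1 := by
    ext k; simp [Pi.single_apply]
  simp [this, mul_comm]

theorem eq_zero_of_dotProduct_eq_zero {ι : Type*} {n : ℕ} {v : ι → Fin n → ℝ} {s : Finset ι}
    (hv : LinearIndepOn ℝ v (s : Set ι)) (hs : s.card = n) {x : Fin n → ℝ}
    (hx : ∀ i ∈ s, x ⬝ᵥ v i = 0) : x = 0 := by
  have hspan : Submodule.span ℝ (Set.range fun i : s => v i) = ⊤ := by
    apply Submodule.eq_top_of_finrank_eq
    have := finrank_span_eq_card (R := ℝ) (b := fun i : s => v i) hv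
    rw [this]; simp [hs]
  have hle : Submodule.span ℝ (Set.range fun i : s => v i) ≤ LinearMap.ker (dotProductBilin ℝ ℝ x) := by
    rw [Submodule.span_le]
    rintro _ ⟨i, rfl⟩
    simpa using hx i i.2
  have : x ⬝ᵥ x = 0 := by
    have h := hle (hspan ▸ Submodule.mem_top : x ∈ _)
    simpa using h
  exact dotProduct_self_eq_zero.1 this

/-- The vectors orthogonal to all `c i`, `i ∈ s`. -/
def orthSub {ι : Type*} {n : ℕ} (c : ι → Fin n → ℝ) (s : Finset ι) : Submodule ℝ (Fin n → ℝ) :=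
  LinearMap.ker (LinearMap.pi fun i : s => dotProductBilin ℝ ℝ (c i))

theorem mem_orthSub {ι : Type*} {n : ℕ} {c : ι → Fin n → ℝ} {s : Finset ι} {x : Fin n → ℝ} :
    x ∈ orthSub c s ↔ ∀ i ∈ s, x ⬝ᵥ c i = 0 := by
  simp [orthSub, funext_iff, dotProduct_comm]

theorem le_finrank_orthSub {ι : Type*} {n : ℕ} (c : ι → Fin n → ℝ) (s : Finset ι) :
    n ≤ finrank ℝ (orthSub c s) + s.card := by
  have h := LinearMap.finrank_range_add_finrank_ker
    (LinearMap.pi fun i : s => dotProductBilin ℝ ℝ (c i))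
  have h2 := Submodule.finrank_le
    (LinearMap.range (LinearMap.pi fun i : s => dotProductBilin ℝ ℝ (c i)))
  simp only [finrank_fintype_fun_eq_card, Fintype.card_coe, Fintype.card_fin] at h h2
  unfold orthSub
  omega

theorem exists_ne_zero_orth {ι : Type*} {n : ℕ} (c : ι → Fin n → ℝ) {s : Finset ι}
    (hs : s.card < n) : ∃ x : Fin n → ℝ, x ≠ 0 ∧ ∀ i ∈ s, x ⬝ᵥ c i = 0 := by
  have h := le_finrank_orthSub c s
  have : orthSub c s ≠ ⊥ := by
    intro h0
    rw [h0, finrank_bot] at h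
    omega
  obtain ⟨x, hx, hx0⟩ := Submodule.exists_mem_ne_zero_of_ne_bot this
  exact ⟨x, hx0, mem_orthSub.1 hx⟩

/-- The orthogonal space has dimension at least two, and a real vector space is not a finite union
of proper subspaces. This is the source of contradictions with `LowRankIn`. -/
theorem exists_orth_not_smul {ι κ : Type*} [Finite κ] {n : ℕ} (c : ι → Fin n → ℝ) {s : Finset ι}
    (hs : s.card + 2 ≤ n) (f : κ → Fin n → ℝ) :
    ∃ x : Fin n → ℝ, (∀ i ∈ s, x ⬝ᵥ c i = 0) ∧ ∀ j (t : ℝ), x ≠ t • f j := by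
  by_contra! hcon
  have hV := le_finrank_orthSub c s
  set V := orthSub c s with hVdef
  have hcov : ⋃ j, ((Submodule.span ℝ {f j}).comap V.subtype : Set V) = Set.univ := by
    refine Set.eq_univ_of_forall fun x => ?_
    obtain ⟨j, t, hx⟩ := hcon x (mem_orthSub.1 x.2)
    refine Set.mem_iUnion.2 ⟨j, ?_⟩
    simp only [Submodule.coe_subtype, SetLike.mem_coe, Submodule.mem_comap]
    exact Submodule.mem_span_singleton.2 ⟨t, hx.symm⟩
  obtain ⟨j, hj⟩ := Subspace.exists_eq_top_of_iUnion_eq_univ hcov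
  have hle : V ≤ Submodule.span ℝ {f j} := by
    intro x hx
    have : (⟨x, hx⟩ : V) ∈ (Submodule.span ℝ {f j}).comap V.subtype := hj ▸ Submodule.mem_top
    simpa using this
  have h1 := Submodule.finrank_mono hle
  have h2 := finrank_span_le_card (R := ℝ) ({f j} : Set (Fin n → ℝ))
  simp only [Set.toFinset_singleton, card_singleton] at h2
  omega

theorem mem_span_singleton_of_orth {n : ℕ} {f x : Fin n → ℝ} (hf : f ≠ 0)
    (h : ∀ u : Fin n → ℝ, f ⬝ᵥ u = 0 → x ⬝ᵥ u = 0) : ∃ t : ℝ, x = t • f := by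
  have hff : f ⬝ᵥ f ≠ 0 := fun h0 => hf (dotProduct_self_eq_zero.1 h0)
  refine ⟨(x ⬝ᵥ f) / (f ⬝ᵥ f), ?_⟩
  set y := x - ((x ⬝ᵥ f) / (f ⬝ᵥ f)) • f with hy
  have hfy : f ⬝ᵥ y = 0 := by
    rw [hy, dotProduct_sub, dotProduct_smul, smul_eq_mul, div_mul_cancel₀ _ hff, dotProduct_comm,
      sub_self]
  have hxy := h y hfy
  have : y ⬝ᵥ y = 0 := by
    nth_rewrite 1 [hy]
    rw [sub_dotProduct, smul_dotProduct, hfy, hxy]; simp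
  exact sub_eq_zero.1 (dotProduct_self_eq_zero.1 this)

/-- Both expansions of `v` are expansions over `s ∪ t`, so their coefficients agree and vanish off
`s ∩ t`. -/
theorem mem_span_inter {ι V : Type*} [DecidableEq ι] [AddCommGroup V] [Module ℝ V] {c : ι → V}
    {s t : Finset ι} (h : LinearIndepOn ℝ c ((s ∪ t : Finset ι) : Set ι)) {v : V}
    (hs : v ∈ Submodule.span ℝ (c '' (s : Set ι))) (ht : v ∈ Submodule.span ℝ (c '' (t : Set ι))) :
    v ∈ Submodule.span ℝ (c '' ((s ∩ t : Finset ι) : Set ι)) := by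
  obtain ⟨α, hα⟩ := (Submodule.mem_span_image_finset_iff_exists_fun ℝ).1 hs
  obtain ⟨β, hβ⟩ := (Submodule.mem_span_image_finset_iff_exists_fun ℝ).1 ht
  let α' : ι → ℝ := fun i => if hi : i ∈ s then α ⟨i, hi⟩ else 0
  let β' : ι → ℝ := fun i => if hi : i ∈ t then β ⟨i, hi⟩ else 0
  have hα' : ∑ i ∈ s, α' i • c i = v := by
    rw [← hα, ← Finset.sum_coe_sort]
    exact Finset.sum_congr rfl fun i _ => by simp [α']
  have hβ' : ∑ i ∈ t, β' i • c i = v := by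
    rw [← hβ, ← Finset.sum_coe_sort]
    exact Finset.sum_congr rfl fun i _ => by simp [β']
  have hα'' : ∑ i ∈ s ∪ t, α' i • c i = v := by
    rw [← hα']
    refine (Finset.sum_subset subset_union_left fun i _ hi => ?_).symm
    simp [α', hi]
  have hβ'' : ∑ i ∈ s ∪ t, β' i • c i = v := by
    rw [← hβ']
    refine (Finset.sum_subset subset_union_right fun i _ hi => ?_).symm
    simp [β', hi]
  have hz := linearIndepOn_finset_iff.1 h (fun i => α' i - β' i) (by
    simp only [sub_smul, Finset.sum_sub_distrib, hα'', hβ'', sub_self])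
  have hzero : ∀ i ∈ s, i ∉ s ∩ t → α' i • c i = 0 := by
    intro i hi hit
    have hi' : i ∉ t := fun h' => hit (mem_inter.2 ⟨hi, h'⟩)
    have h1 := hz i (mem_union_left _ hi)
    have h2 : β' i = 0 := by simp [β', hi']
    rw [h2, sub_zero] at h1
    rw [h1, zero_smul]
  rw [← hα', ← Finset.sum_subset inter_subset_left hzero]
  exact Submodule.sum_mem _ fun i hi =>
    Submodule.smul_mem _ _ (Submodule.subset_span ⟨i, by exact_mod_cast hi, rfl⟩)

/-! ### Counting spanned subsets -/

section Counting

variable {ι : Type*} [DecidableEq ι]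

theorem card_filter_mem_powersetCard {X : Finset ι} {r : ι} (hr : r ∈ X) (k : ℕ) :
    {S ∈ X.powersetCard (k + 1) | r ∈ S}.card = (X.card - 1).choose k := by
  rw [← card_erase_of_mem hr, ← card_powersetCard]
  symm
  refine Finset.card_bij (fun S _ => insert r S) ?_ ?_ ?_
  · intro S hS
    rw [mem_powersetCard] at hS
    have hrS : r ∉ S := fun h => by simpa using hS.1 h
    simp only [mem_filter, mem_powersetCard, mem_insert_self, and_true, card_insert_of_notMem hrS,
      hS.2]
    exact insert_subset hr (hS.1.trans (erase_subset _ _))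
  · intro S hS S' hS' h
    rw [mem_powersetCard] at hS hS'
    have hrS : r ∉ S := fun h => by simpa using hS.1 h
    have hrS' : r ∉ S' := fun h => by simpa using hS'.1 h
    rw [← erase_insert hrS, h, erase_insert hrS']
  · intro S hS
    rw [mem_filter, mem_powersetCard] at hS
    refine ⟨S.erase r, ?_, insert_erase hS.2⟩
    rw [mem_powersetCard, card_erase_of_mem hS.2, hS.1.2]
    exact ⟨erase_subset_erase _ hS.1.1, rfl⟩

/-- Strictness for the double count below. With `n = a + 2`, after multiplying by `k + 1` the two
sides differ by `(a - k) * a.choose k`. -/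
theorem mul_choose_lt {n k : ℕ} (hn : k + 3 ≤ n) :
    n * (n - 2).choose k < (k + 2) * (n - 1).choose (k + 1) := by
  obtain ⟨a, rfl⟩ : ∃ a, n = a + 2 := ⟨n - 2, by omega⟩
  have h1 : (a + 1) * a.choose k = (a + 1).choose (k + 1) * (k + 1) := Nat.add_one_mul_choose_eq a k
  have h2 : 0 < a.choose k := Nat.choose_pos (by omega)
  have h3 : a + 2 - 2 = a := by omega
  have h4 : a + 2 - 1 = a + 1 := by omega
  rw [h3, h4]
  refine lt_of_mul_lt_mul_right (a := k + 1) ?_ (by omega)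
  rw [mul_assoc (k + 2), ← h1]
  nlinarith

-- `P S` will mean that a fixed nonzero vector lies in the span of the columns indexed by `S`; the
-- bounded union in the intersection hypothesis reflects that only small sets of columns are known
-- to be independent. The induction passes to the link of a point, and a double count of pairs `r ∈
-- S` gives the strict bound when no singleton has `P`.
open Classical in
theorem card_filter_powersetCard_le (k : ℕ) : ∀ (X : Finset ι) (P : Finset ι → Prop),
    k + 2 ≤ X.card → ¬ P ∅ →
    (∀ S T : Finset ι, S ⊆ T → P S → P T) →
    (∀ S T : Finset ι, S ⊆ X → T ⊆ X → (S ∪ T).card ≤ k + 2 → P S → P T → P (S ∩ T)) →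
    {S ∈ X.powersetCard (k + 1) | P S}.card ≤ (X.card - 1).choose k ∧
      ((∀ r ∈ X, ¬ P {r}) → {S ∈ X.powersetCard (k + 1) | P S}.card < (X.card - 1).choose k) := by
  induction k with
  | zero =>
    intro X P hX h0 hmono hinter
    constructor
    · rw [Nat.choose_zero_right, Finset.card_le_one]
      intro S hS T hT
      simp only [zero_add, mem_filter, mem_powersetCard] at hS hT
      obtain ⟨a, rfl⟩ := card_eq_one.1 hS.1.2
      obtain ⟨b, rfl⟩ := card_eq_one.1 hT.1.2
      by_contra hne
      have hab : a ≠ b := fun h => hne (by rw [h])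
      apply h0
      have := hinter {a} {b} hS.1.1 hT.1.1 (by rw [card_union]; simp) hS.2 hT.2
      simpa [hab] using this
    · intro h1
      rw [Nat.choose_zero_right, Nat.lt_one_iff, card_eq_zero, filter_eq_empty_iff]
      intro S hS
      rw [mem_powersetCard] at hS
      obtain ⟨a, rfl⟩ := card_eq_one.1 hS.2
      exact h1 a (hS.1 (mem_singleton_self a))
  | succ k ih =>
    intro X P hX h0 hmono hinter
    suffices h : (∃ r ∈ X, P {r} ∧
        {S ∈ X.powersetCard (k + 1 + 1) | P S}.card = (X.card - 1).choose (k + 1)) ∨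
        {S ∈ X.powersetCard (k + 1 + 1) | P S}.card < (X.card - 1).choose (k + 1) by
      rcases h with ⟨r, hr, hPr, h⟩ | h
      · exact ⟨h.le, fun h1 => (h1 r hr hPr).elim⟩
      · exact ⟨h.le, fun _ => h⟩
    -- If `P {r}` holds, the sets with `P` are exactly those containing `r`: any other would meet
    -- `{r}` in `∅`.
    by_cases hP : ∃ r ∈ X, P {r}
    · left
      obtain ⟨r, hr, hPr⟩ := hP
      refine ⟨r, hr, hPr, ?_⟩
      rw [← card_filter_mem_powersetCard hr]
      congr 1
      refine filter_congr fun S hS => ⟨fun hPS => ?_, fun hrS => hmono _ _ (by simpa using hrS) hPr⟩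
      by_contra hrS
      rw [mem_powersetCard] at hS
      apply h0
      have := hinter S {r} hS.1 (by simpa using hr)
        ((card_union_le _ _).trans (by rw [hS.2]; simp)) hPS hPr
      rwa [inter_singleton_of_notMem hrS] at this
    · right
      push Not at hP
      set D := {S ∈ X.powersetCard (k + 1 + 1) | P S} with hD
      have hr : ∀ r ∈ X, {S ∈ D | r ∈ S}.card ≤ (X.card - 2).choose k := by
        intro r hr
        have hc : (X.erase r).card = X.card - 1 := card_erase_of_mem hr
        -- The link of `r` satisfies the hypotheses again; that it omits `∅` is the failure of `P
        -- {r}`.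
        obtain ⟨h1, -⟩ := ih (X.erase r) (fun S => P (insert r S)) (by omega)
          (by simpa using hP r hr) (fun S T hST => hmono _ _ (insert_subset_insert _ hST)) (by
            intro S T hS hT hST hPS hPT
            have := hinter (insert r S) (insert r T) (insert_subset hr (hS.trans (erase_subset _ _)))
              (insert_subset hr (hT.trans (erase_subset _ _))) (by
                rw [← insert_union_distrib]
                exact (card_insert_le _ _).trans (by omega)) hPS hPT
            rwa [← insert_inter_distrib] at this)
        rw [hc, Nat.sub_sub] at h1
        refine le_trans ?_ h1
        refine Finset.card_le_card_of_injOn (fun S => S.erase r) ?_ ?_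
        · intro S hS
          simp only [hD, coe_filter, mem_filter, mem_powersetCard, Set.mem_ofPred_eq] at hS ⊢
          rw [card_erase_of_mem hS.2, hS.1.1.2, insert_erase hS.2]
          exact ⟨⟨erase_subset_erase _ hS.1.1.1, rfl⟩, hS.1.2⟩
        · intro S hS T hT h
          simp only [coe_filter, Set.mem_ofPred_eq] at hS hT
          rw [← insert_erase hS.2, ← insert_erase hT.2]
          exact congrArg _ h
      have hdc := sum_card_bipartiteAbove_eq_sum_card_bipartiteBelow (s := X) (t := D)
        (fun r S => r ∈ S)
      have hbelow : ∑ S ∈ D, (bipartiteBelow (fun r S => r ∈ S) X S).card = D.card * (k + 2) := by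
        rw [Finset.sum_const_nat]
        intro S hS
        simp only [hD, mem_filter, mem_powersetCard] at hS
        rw [← hS.1.2]
        congr 1
        ext r
        simp only [bipartiteBelow, mem_filter, and_iff_right_iff_imp]
        exact fun h => hS.1.1 h
      have habove : ∑ r ∈ X, (bipartiteAbove (fun r S => r ∈ S) D r).card ≤
          X.card * (X.card - 2).choose k := by
        rw [← smul_eq_mul]
        exact Finset.sum_le_card_nsmul _ _ _ hr
      rw [hdc, hbelow] at habove
      have := mul_choose_lt (n := X.card) (k := k) (by omega)
      refine lt_of_mul_lt_mul_right (a := k + 2) ?_ (by omega)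
      calc _ ≤ _ := habove
        _ < _ := this
        _ = _ := mul_comm _ _

end Counting

/-- If `v` is in the span of `c_U` for all `U ∋ r` of cardinality `p` and every `p + 1` of the `c_i` are
linearly independent, then `v` is a multiple of `c_r`. -/
theorem mem_span_singleton_of_forall_mem_span {ι V : Type*} [DecidableEq ι] [Fintype ι]
    [AddCommGroup V] [Module ℝ V] {c : ι → V} {p : ℕ}
    (hp : 1 ≤ p) (hc : ∀ s : Finset ι, s.card ≤ p + 1 → LinearIndepOn ℝ c (s : Set ι))
    (hcard : p + 1 ≤ Fintype.card ι) {v : V} (r : ι)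
    (hv : ∀ U : Finset ι, r ∈ U → U.card = p → v ∈ Submodule.span ℝ (c '' (U : Set ι))) :
    ∃ t : ℝ, v = t • c r := by
  -- Descent on the size of `U`: it is the intersection of two one-point enlargements, whose union
  -- has at most `p + 1` elements.
  have key : ∀ d : ℕ, ∀ U : Finset ι, r ∈ U → U.card + d = p →
      v ∈ Submodule.span ℝ (c '' (U : Set ι)) := by
    intro d
    induction d with
    | zero => exact fun U hr hU => hv U hr hU
    | succ d ih =>
      intro U hr hU
      obtain ⟨q, hq⟩ : ∃ q, q ∉ U := by
        by_contra! h
        rw [Finset.eq_univ_iff_forall.2 h, card_univ] at hU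
        omega
      obtain ⟨q', hq'⟩ : ∃ q', q' ∉ insert q U := by
        by_contra! h
        have := card_insert_le q U
        rw [Finset.eq_univ_iff_forall.2 h, card_univ] at this
        omega
      rw [mem_insert, not_or] at hq'
      have h1 := ih (insert q U) (mem_insert_of_mem hr) (by rw [card_insert_of_notMem hq]; omega)
      have h2 := ih (insert q' U) (mem_insert_of_mem hr)
        (by rw [card_insert_of_notMem hq'.2]; omega)
      have h3 := mem_span_inter (hc _ (by
        have : insert q U ∪ insert q' U = insert q (insert q' U) := by ext; simp; tauto
        rw [this]
        have := card_insert_le q (insert q' U)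
        have := card_insert_le q' U
        omega)) h1 h2
      have : insert q U ∩ insert q' U = U := by
        ext x
        simp only [mem_inter, mem_insert]
        constructor
        · rintro ⟨rfl | h, rfl | h'⟩
          · exact (hq'.1 rfl).elim
          all_goals assumption
        · exact fun h => ⟨Or.inr h, Or.inr h⟩
      rwa [this] at h3
  have h1 := key (p - 1) {r} (mem_singleton_self r) (by rw [card_singleton]; omega)
  rw [coe_singleton, Set.image_singleton, Submodule.mem_span_singleton] at h1
  obtain ⟨t, ht⟩ := h1
  exact ⟨t, ht.symm⟩

/-! ### Contractions of a polyadic decomposition -/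

section Contract

variable {I J K R : ℕ} {A : Matrix (Fin I) (Fin R) ℝ} {B : Matrix (Fin J) (Fin R) ℝ}
  {C : Matrix (Fin K) (Fin R) ℝ} {f : Fin K → ℝ} {U : Finset (Fin R)}

theorem contract_polyadic_apply (i : Fin I) (j : Fin J) :
    contract (polyadic A B C) f i j = ∑ r, (f ⬝ᵥ C.col r) * (A i r * B j r) := by
  simp only [contract, polyadic, Matrix.of_apply, dotProduct, Matrix.col_apply, Finset.sum_mul]
  rw [Finset.sum_comm]
  exact Finset.sum_congr rfl fun r _ => Finset.sum_congr rfl fun k _ => by ring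

theorem contract_polyadic_mulVec (y : Fin J → ℝ) :
    contract (polyadic A B C) f *ᵥ y = ∑ r, ((f ⬝ᵥ C.col r) * (y ⬝ᵥ B.col r)) • A.col r := by
  ext i
  simp only [Matrix.mulVec, dotProduct, contract_polyadic_apply, Finset.sum_apply, Pi.smul_apply,
    smul_eq_mul, Matrix.col_apply, Finset.sum_mul, Finset.mul_sum]
  rw [Finset.sum_comm]
  refine Finset.sum_congr rfl fun r _ => Finset.sum_congr rfl fun j _ => ?_
  refine Finset.sum_congr rfl fun k _ => ?_
  ring

theorem contract_polyadic_transpose :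
    (contract (polyadic A B C) f)ᵀ = contract (polyadic B A C) f := by
  ext j i
  rw [Matrix.transpose_apply, contract_polyadic_apply, contract_polyadic_apply]
  exact Finset.sum_congr rfl fun r _ => by ring

theorem range_contract_le (hU : ∀ r, r ∉ U → f ⬝ᵥ C.col r = 0) :
    LinearMap.range (contract (polyadic A B C) f).mulVecLin ≤
      Submodule.span ℝ (A.col '' (U : Set (Fin R))) := by
  rintro _ ⟨y, rfl⟩
  rw [Matrix.mulVecLin_apply, contract_polyadic_mulVec]
  refine Submodule.sum_mem _ fun r _ => ?_
  by_cases hr : r ∈ U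
  · exact Submodule.smul_mem _ _ (Submodule.subset_span ⟨r, hr, rfl⟩)
  · simp [hU r hr]

theorem finrank_span_image_le {ι V : Type*} [AddCommGroup V] [Module ℝ V] (c : ι → V)
    (s : Finset ι) : finrank ℝ (Submodule.span ℝ (c '' (s : Set ι))) ≤ s.card := by
  classical
  rw [← coe_image]
  exact (finrank_span_finset_le_card _).trans card_image_le

theorem finrank_span_image_lt {ι V : Type*} [AddCommGroup V] [Module ℝ V] {c : ι → V}
    {s : Finset ι} (h : ¬ LinearIndepOn ℝ c (s : Set ι)) :
    finrank ℝ (Submodule.span ℝ (c '' (s : Set ι))) < s.card := by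
  by_contra! hcon
  apply h
  refine linearIndependent_iff_card_le_finrank_span.2 ?_
  rw [Set.finrank]
  rw [Set.image_eq_range] at hcon
  simpa using hcon

theorem finrank_span_image_eq {ι V : Type*} [AddCommGroup V] [Module ℝ V] {c : ι → V}
    {s : Finset ι} (h : LinearIndepOn ℝ c (s : Set ι)) :
    finrank ℝ (Submodule.span ℝ (c '' (s : Set ι))) = s.card := by
  have := finrank_span_eq_card h
  rw [Set.image_eq_range]
  simpa using this

theorem rank_contract_le (hU : ∀ r, r ∉ U → f ⬝ᵥ C.col r = 0) :
    (contract (polyadic A B C) f).rank ≤ U.card :=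
  (Submodule.finrank_mono (range_contract_le hU)).trans (finrank_span_image_le _ _)

theorem rank_contract_lt (hU : ∀ r, r ∉ U → f ⬝ᵥ C.col r = 0)
    (hA : ¬ LinearIndepOn ℝ A.col (U : Set (Fin R))) :
    (contract (polyadic A B C) f).rank < U.card :=
  (Submodule.finrank_mono (range_contract_le hU)).trans_lt (finrank_span_image_lt hA)

/-- Independence of the relevant `b_q` gives a `y` that annihilates every term but the `r`-th; no
independence of the `a_q` enters. -/
theorem mem_range_contract (hU : ∀ r, r ∉ U → f ⬝ᵥ C.col r = 0)
    (hB : LinearIndepOn ℝ B.col (U : Set (Fin R))) {r : Fin R} (hr : f ⬝ᵥ C.col r ≠ 0) :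
    A.col r ∈ LinearMap.range (contract (polyadic A B C) f).mulVecLin := by
  obtain ⟨y, hy⟩ := exists_dotProduct_eq hB (fun q => if q = r then (f ⬝ᵥ C.col r)⁻¹ else 0)
  refine ⟨y, ?_⟩
  rw [Matrix.mulVecLin_apply, contract_polyadic_mulVec, Finset.sum_eq_single r]
  · have hrU : r ∈ U := by
      by_contra h
      exact hr (hU r h)
    rw [hy r hrU, if_pos rfl, mul_inv_cancel₀ hr, one_smul]
  · intro q _ hq
    by_cases hqU : q ∈ U
    · rw [hy q hqU, if_neg hq, mul_zero, zero_smul]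
    · rw [hU q hqU, zero_mul, zero_smul]
  · simp

theorem range_contract_eq_of_card_le_rank (hU : ∀ r, r ∉ U → f ⬝ᵥ C.col r = 0)
    (h : U.card ≤ (contract (polyadic A B C) f).rank) :
    LinearMap.range (contract (polyadic A B C) f).mulVecLin =
      Submodule.span ℝ (A.col '' (U : Set (Fin R))) :=
  Submodule.eq_of_le_of_finrank_le (range_contract_le hU) ((finrank_span_image_le _ _).trans h)

theorem rank_contract_eq (hU : ∀ r, r ∉ U ↔ f ⬝ᵥ C.col r = 0)
    (hA : LinearIndepOn ℝ A.col (U : Set (Fin R))) (hB : LinearIndepOn ℝ B.col (U : Set (Fin R))) :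
    (contract (polyadic A B C) f).rank = U.card := by
  refine le_antisymm (rank_contract_le fun r => (hU r).1) ?_
  rw [← finrank_span_image_eq hA]
  refine Submodule.finrank_mono (Submodule.span_le.2 ?_)
  rintro _ ⟨r, hr, rfl⟩
  refine mem_range_contract (fun r => (hU r).1) hB fun h0 => ?_
  exact (hU r).2 h0 hr

end Contract

/-! ### Symmetric powers in the kernel of `R_{m,l}(T)` -/

/-- The vectorized symmetric power `x ⊗ ⋯ ⊗ x`. -/
def symPow {K : ℕ} (x : Fin K → ℝ) (n : ℕ) : (Fin n → Fin K) → ℝ := fun k => ∏ p, x (k p)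

theorem symPow_mem_symSubspace {K : ℕ} (x : Fin K → ℝ) (n : ℕ) : symPow x n ∈ symSubspace K n :=
  Submodule.subset_span ⟨x, rfl⟩

/-- For each permutation in the determinant the summand is a product with one factor per position,
so the sum over multi-indices factors into contractions. -/
theorem sum_det_mul_prod {I J K : ℕ} (m l : ℕ) (T : Tensor3 I J K) (f : Fin K → ℝ)
    (i : Fin (m + l) → Fin I) (j : Fin (m + l) → Fin J) :
    ∑ k : Fin (m + l) → Fin K, ((Matrix.of fun p q : Fin m =>
        T (i (Fin.castAdd l p)) (j (Fin.castAdd l q)) (k (Fin.castAdd l q))).det *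
          ∏ p : Fin l, T (i (Fin.natAdd m p)) (j (Fin.natAdd m p)) (k (Fin.natAdd m p))) *
            symPow f (m + l) k =
      ((contract T f).submatrix (fun p : Fin m => i (Fin.castAdd l p))
        fun q => j (Fin.castAdd l q)).det *
          ∏ p : Fin l, contract T f (i (Fin.natAdd m p)) (j (Fin.natAdd m p)) := by
  simp only [Matrix.det_apply, Finset.sum_mul, Matrix.of_apply, Matrix.submatrix_apply]
  rw [Finset.sum_comm]
  refine Finset.sum_congr rfl fun τ _ => ?_
  simp only [smul_mul_assoc, ← Finset.smul_sum]
  congr 1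
  have h : ∀ k : Fin (m + l) → Fin K,
      ((∏ q : Fin m, T (i (Fin.castAdd l (τ q))) (j (Fin.castAdd l q)) (k (Fin.castAdd l q))) *
        ∏ p : Fin l, T (i (Fin.natAdd m p)) (j (Fin.natAdd m p)) (k (Fin.natAdd m p))) *
          symPow f (m + l) k =
      ∏ x : Fin (m + l), T (i (Fin.addCases (fun q => Fin.castAdd l (τ q)) (Fin.natAdd m) x))
        (j x) (k x) * f (k x) := by
    intro k
    rw [Finset.prod_mul_distrib, symPow]
    congr 1
    rw [Fin.prod_univ_add]
    simp
  rw [Finset.sum_congr rfl fun k _ => h k,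
    ← Fintype.prod_sum (fun (x : Fin (m + l)) (κ : Fin K) =>
      T (i (Fin.addCases (fun q => Fin.castAdd l (τ q)) (Fin.natAdd m) x)) (j x) κ * f κ),
    Fin.prod_univ_add]
  simp [contract]

/-- A symmetric power is invariant under rearrangement, so all `(m+l)!` summands contribute equally
and cancel that factorial. -/
theorem RMatrix_mulVec_symPow {I J K : ℕ} (m l : ℕ) (T : Tensor3 I J K) (f : Fin K → ℝ)
    (ij : (Fin (m + l) → Fin I) × (Fin (m + l) → Fin J)) :
    (RMatrix m l T *ᵥ symPow f (m + l)) ij =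
      (1 / (m.factorial : ℝ)) * (((contract T f).submatrix (fun p : Fin m => ij.1 (Fin.castAdd l p))
        fun q => ij.2 (Fin.castAdd l q)).det *
          ∏ p : Fin l, contract T f (ij.1 (Fin.natAdd m p)) (ij.2 (Fin.natAdd m p))) := by
  simp only [Matrix.mulVec, dotProduct, RMatrix, Matrix.of_apply, mul_assoc, Finset.sum_mul]
  rw [← Finset.mul_sum, Finset.sum_comm]
  have h : ∀ σ : Equiv.Perm (Fin (m + l)),
      ∑ k : Fin (m + l) → Fin K, ((Matrix.of fun p q : Fin m =>
        T (ij.1 (Fin.castAdd l p)) (ij.2 (Fin.castAdd l q)) (k (σ (Fin.castAdd l q)))).det *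
          ((∏ p : Fin l, T (ij.1 (Fin.natAdd m p)) (ij.2 (Fin.natAdd m p))
            (k (σ (Fin.natAdd m p)))) * symPow f (m + l) k)) =
      ((contract T f).submatrix (fun p : Fin m => ij.1 (Fin.castAdd l p))
        fun q => ij.2 (Fin.castAdd l q)).det *
          ∏ p : Fin l, contract T f (ij.1 (Fin.natAdd m p)) (ij.2 (Fin.natAdd m p)) := by
    intro σ
    rw [← sum_det_mul_prod]
    refine Fintype.sum_equiv (Equiv.arrowCongr σ.symm (Equiv.refl _)) _ _ fun k => ?_
    have : symPow f (m + l) (k ∘ σ) = symPow f (m + l) k :=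
      Equiv.prod_comp σ fun p => f (k p)
    simp [Equiv.arrowCongr, ← this, mul_assoc, Function.comp_def]
  rw [Finset.sum_congr rfl fun σ _ => h σ, Finset.sum_const, card_univ, Fintype.card_perm,
    Fintype.card_fin, nsmul_eq_mul, ← mul_assoc]
  congr 1
  have h1 : ((m + l).factorial : ℝ) ≠ 0 := by positivity
  field_simp

theorem symPow_mem_symKer {I J K : ℕ} {m l : ℕ} {T : Tensor3 I J K} {f : Fin K → ℝ}
    (h : (contract T f).rank < m) : symPow f (m + l) ∈ symKer m l T := by
  refine ⟨?_, symPow_mem_symSubspace f _⟩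
  change RMatrix m l T *ᵥ symPow f (m + l) = 0
  ext ij
  rw [RMatrix_mulVec_symPow]
  have hdet : ((contract T f).submatrix (fun p : Fin m => ij.1 (Fin.castAdd l p))
      fun q => ij.2 (Fin.castAdd l q)).det = 0 := by
    by_contra hne
    have h1 := Matrix.rank_of_isUnit _ ((Matrix.isUnit_iff_isUnit_det _).2 (isUnit_iff_ne_zero.2 hne))
    have h2 := Matrix.rank_submatrix_le (contract T f) (fun p : Fin m => ij.1 (Fin.castAdd l p))
      fun q => ij.2 (Fin.castAdd l q)
    rw [h1, Fintype.card_fin] at h2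
    omega
  rw [hdet]
  simp

/-! ### Enumerations of the subsets of given cardinality -/

/-- `g` takes every `k`-subset of `Fin R` as a value, and no other sets. -/
def EnumSubsets {R N : ℕ} (k : ℕ) (g : Fin N → Finset (Fin R)) : Prop :=
  (∀ j, (g j).card = k) ∧ ∀ S : Finset (Fin R), S.card = k → ∃ j, g j = S

namespace EnumSubsets

variable {R k : ℕ} {g : Fin (R.choose k) → Finset (Fin R)}

theorem image_eq (hg : EnumSubsets k g) : univ.image g = powersetCard k univ := by
  ext S
  simp only [mem_image, mem_univ, true_and, mem_powersetCard, subset_univ]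
  exact ⟨fun ⟨j, hj⟩ => hj ▸ hg.1 j, hg.2 S⟩

/-- A map from a set of `R.choose k` elements onto the `k`-subsets has no room for repetitions. -/
theorem injective (hg : EnumSubsets k g) : Function.Injective g := by
  rw [← Set.injOn_univ, ← coe_univ, ← card_image_iff, hg.image_eq, card_powersetCard, card_univ,
    card_univ, Fintype.card_fin, Fintype.card_fin]

open Classical in
theorem card_filter (hg : EnumSubsets k g) (P : Finset (Fin R) → Prop) :
    ((univ : Finset (Fin (R.choose k))).filter fun j => P (g j)).card =
      {S ∈ powersetCard k (univ : Finset (Fin R)) | P S}.card := by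
  rw [← hg.image_eq, filter_image, card_image_of_injective _ hg.injective]

theorem card_filter_mem {k : ℕ} {g : Fin (R.choose (k + 1)) → Finset (Fin R)}
    (hg : EnumSubsets (k + 1) g) (r : Fin R) : (univ.filter fun j => r ∈ g j).card = (R - 1).choose k := by
  have h := hg.card_filter (fun S => r ∈ S)
  have h2 := card_filter_mem_powersetCard (mem_univ r) k
  rw [card_univ, Fintype.card_fin] at h2
  rw [← h2]
  convert h

end EnumSubsets

/-! ### Vectors orthogonal to columns of a matrix in general position -/

/-- The columns of `C` are in general position: any `K` of them are linearly independent. -/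
def GenPos {K R : ℕ} (C : Matrix (Fin K) (Fin R) ℝ) : Prop :=
  ∀ s : Finset (Fin R), s.card ≤ K → LinearIndepOn ℝ C.col (s : Set (Fin R))

theorem genPos_of_kRank {K R : ℕ} {C : Matrix (Fin K) (Fin R) ℝ} (h : kRank C = K) :
    GenPos C := by
  have hmem := Nat.sSup_mem (s := {k : ℕ | k ≤ R ∧ ∀ s : Finset (Fin R), s.card = k →
    LinearIndependent ℝ (fun r : s => C.col r)}) ⟨0, Nat.zero_le _, fun s hs => by
      rw [card_eq_zero] at hs
      subst hs
      exact linearIndependent_empty_type⟩ ⟨R, fun k hk => hk.1⟩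
  change kRank C ∈ _ at hmem
  rw [h] at hmem
  intro s hs
  obtain ⟨t, hst, ht⟩ := Finset.exists_superset_card_eq hs (by simpa using hmem.1)
  have h1 : LinearIndepOn ℝ C.col (t : Set (Fin R)) := hmem.2 t ht
  exact h1.mono (by exact_mod_cast hst)

open Classical in
/-- The indices of the columns of `C` that are orthogonal to `x`. -/
noncomputable def zeros {K R : ℕ} (C : Matrix (Fin K) (Fin R) ℝ) (x : Fin K → ℝ) : Finset (Fin R) :=
  {r | x ⬝ᵥ C.col r = 0}

section Zeros

variable {K R : ℕ} {C : Matrix (Fin K) (Fin R) ℝ} {x y : Fin K → ℝ}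

theorem mem_zeros {r : Fin R} : r ∈ zeros C x ↔ x ⬝ᵥ C.col r = 0 := by
  simp [zeros]

theorem ncard_eq_card_zeros : {r | x ⬝ᵥ C.col r = 0}.ncard = (zeros C x).card := by
  rw [← Set.ncard_coe_finset]
  congr 1
  ext r
  simp [mem_zeros]

theorem zeros_smul {t : ℝ} (ht : t ≠ 0) : zeros C (t • x) = zeros C x := by
  ext r
  simp [mem_zeros, ht]

theorem isNormalMatrix_iff {F : Matrix (Fin K) (Fin (R.choose (K - 1))) ℝ} :
    IsNormalMatrix C F ↔ (∀ j, (zeros C (F.col j)).card = K - 1) ∧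
      ∀ x, (zeros C x).card = K - 1 → ∃ (j : _) (t : ℝ), x = t • F.col j := by
  simp only [IsNormalMatrix, ncard_eq_card_zeros]

theorem GenPos.eq_zero (hC : GenPos C) {S : Finset (Fin R)} (hS : K ≤ S.card)
    (hx : S ⊆ zeros C x) : x = 0 := by
  obtain ⟨t, htS, ht⟩ := exists_subset_card_eq hS
  exact eq_zero_of_dotProduct_eq_zero (hC t ht.le) ht fun i hi => mem_zeros.1 (hx (htS hi))

theorem GenPos.exists_smul_eq (hC : GenPos C) (hK : 1 ≤ K) (hKR : K ≤ R) {S : Finset (Fin R)}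
    (hS : S.card = K - 1) (hx : S ⊆ zeros C x) (hy : S ⊆ zeros C y) (hy0 : y ≠ 0) :
    ∃ t : ℝ, x = t • y := by
  obtain ⟨r, hr⟩ : ∃ r, r ∉ S := by
    by_contra! h
    rw [Finset.eq_univ_iff_forall.2 h, card_univ, Fintype.card_fin] at hS
    omega
  have hcard : K ≤ (insert r S).card := by
    rw [card_insert_of_notMem hr]
    omega
  have hyr : y ⬝ᵥ C.col r ≠ 0 := fun h =>
    hy0 (hC.eq_zero hcard (insert_subset (mem_zeros.2 h) hy))
  refine ⟨(x ⬝ᵥ C.col r) / (y ⬝ᵥ C.col r), sub_eq_zero.1 (hC.eq_zero hcard ?_)⟩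
  intro q hq
  rw [mem_zeros, sub_dotProduct, smul_dotProduct, smul_eq_mul]
  rcases mem_insert.1 hq with rfl | hq
  · rw [div_mul_cancel₀ _ hyr, sub_self]
  · rw [mem_zeros.1 (hx hq), mem_zeros.1 (hy hq), mul_zero, sub_zero]

theorem GenPos.exists_zeros_eq (hC : GenPos C) (hK : 1 ≤ K) {S : Finset (Fin R)}
    (hS : S.card = K - 1) : ∃ x : Fin K → ℝ, zeros C x = S := by
  obtain ⟨x, hx0, hx⟩ := exists_ne_zero_orth C.col (s := S) (by omega)
  have hsub : S ⊆ zeros C x := fun r hr => mem_zeros.2 (hx r hr)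
  refine ⟨x, (eq_of_subset_of_card_le hsub ?_).symm⟩
  by_contra! hlt
  exact hx0 (hC.eq_zero (S := zeros C x) (by omega) Subset.rfl)

theorem GenPos.exists_isNormalMatrix (hC : GenPos C) (hK : 1 ≤ K) (hKR : K ≤ R) :
    ∃ F, IsNormalMatrix C F := by
  have hc : Fintype.card (Fin (R.choose (K - 1))) =
      Fintype.card (powersetCard (K - 1) (univ : Finset (Fin R))) := by simp
  let e := Fintype.equivOfCardEq hc
  have he : ∀ j, (e j : Finset (Fin R)).card = K - 1 := fun j => (mem_powersetCard.1 (e j).2).2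
  choose f hf using fun j => hC.exists_zeros_eq hK (he j)
  refine ⟨Matrix.of fun k j => f j k, isNormalMatrix_iff.2 ⟨fun j => ?_, fun x hx => ?_⟩⟩
  · exact (congrArg card (hf j)).trans (he j)
  · let j := e.symm ⟨zeros C x, by simp [hx]⟩
    have hj : zeros C (f j) = zeros C x := by
      rw [hf]
      simp [j]
    have hf0 : f j ≠ 0 := by
      intro h0
      have h1 : (zeros C (f j)).card = K - 1 := by rw [hf, he]
      rw [h0, show zeros C 0 = univ by ext; simp [mem_zeros], card_univ, Fintype.card_fin] at h1
      omega
    obtain ⟨t, ht⟩ := hC.exists_smul_eq hK hKR hx (x := x) Subset.rfl (hj ▸ Subset.rfl) hf0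
    exact ⟨j, t, ht⟩

variable {F : Matrix (Fin K) (Fin (R.choose (K - 1))) ℝ}

theorem IsNormalMatrix.col_ne_zero (hF : IsNormalMatrix C F) (hK : 1 ≤ K) (hKR : K ≤ R)
    (j : Fin (R.choose (K - 1))) : F.col j ≠ 0 := by
  intro h0
  have h1 := (isNormalMatrix_iff.1 hF).1 j
  rw [h0, show zeros C 0 = univ by ext; simp [mem_zeros], card_univ, Fintype.card_fin] at h1
  omega

theorem IsNormalMatrix.enumSubsets (hF : IsNormalMatrix C F) (hC : GenPos C) (hK : 1 ≤ K)
    (hKR : K ≤ R) : EnumSubsets (K - 1) fun j => zeros C (F.col j) := by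
  rw [isNormalMatrix_iff] at hF
  refine ⟨hF.1, fun S hS => ?_⟩
  obtain ⟨x, hx⟩ := hC.exists_zeros_eq hK hS
  obtain ⟨j, t, ht⟩ := hF.2 x (by rw [hx, hS])
  refine ⟨j, ?_⟩
  have ht0 : t ≠ 0 := by
    rintro rfl
    rw [ht, zero_smul, show zeros C 0 = univ by ext; simp [mem_zeros]] at hx
    rw [← hx, card_univ, Fintype.card_fin] at hS
    omega
  rw [← hx, ht, zeros_smul ht0]

theorem IsNormalMatrix.exists_mem_notMem (hF : IsNormalMatrix C F) (hC : GenPos C) (hK : 1 ≤ K)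
    (hKR : K ≤ R) {i j : Fin (R.choose (K - 1))} (hij : i ≠ j) :
    ∃ r, F.col i ⬝ᵥ C.col r = 0 ∧ F.col j ⬝ᵥ C.col r ≠ 0 := by
  have hE := hF.enumSubsets hC hK hKR
  by_contra! h
  refine hij (hE.injective (eq_of_subset_of_card_le (fun r hr => ?_) (by rw [hE.1, hE.1])))
  exact mem_zeros.2 (h r (mem_zeros.1 hr))

theorem IsNormalMatrix.exists_ne_zero (hF : IsNormalMatrix C F) (hK : 1 ≤ K)
    (hKR : K ≤ R) (j : Fin (R.choose (K - 1))) : ∃ r, F.col j ⬝ᵥ C.col r ≠ 0 := by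
  by_contra! h
  have h1 := (isNormalMatrix_iff.1 hF).1 j
  rw [Finset.eq_univ_iff_forall.2 fun r => mem_zeros.2 (h r), card_univ, Fintype.card_fin] at h1
  omega

theorem IsNormalMatrix.two_le_kRank (hF : IsNormalMatrix C F) (hC : GenPos C) (hK : 2 ≤ K)
    (hKR : K ≤ R) : 2 ≤ kRank F := by
  refine le_csSup ⟨_, fun k hk => hk.1⟩ ⟨?_, fun s hs => ?_⟩
  · obtain ⟨R, rfl⟩ : ∃ R', R = R' + 1 := ⟨R - 1, by omega⟩
    obtain ⟨k, rfl⟩ : ∃ k, K = k + 2 := ⟨K - 2, by omega⟩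
    have h1 : 0 < R.choose k := Nat.choose_pos (by omega)
    have h2 : 0 < R.choose (k + 1) := Nat.choose_pos (by omega)
    have h3 : (R + 1).choose (k + 2 - 1) = R.choose k + R.choose (k + 1) :=
      Nat.choose_succ_succ _ _
    omega
  · obtain ⟨i, j, hij, rfl⟩ := card_eq_two.1 hs
    have : LinearIndepOn ℝ F.col (({i, j} : Finset (Fin (R.choose (K - 1)))) : Set _) := by
      rw [linearIndepOn_finset_iff]
      intro g hg
      rw [sum_pair hij] at hg
      have key : ∀ a b : Fin (R.choose (K - 1)), a ≠ b →
          g a • F.col a + g b • F.col b = 0 → g a = 0 := by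
        intro a b hab h
        obtain ⟨r, hr, hr'⟩ := hF.exists_mem_notMem hC (by omega) hKR hab.symm
        have := congrArg (fun z => z ⬝ᵥ C.col r) h
        simpa [add_dotProduct, smul_dotProduct, hr, hr'] using this
      intro q hq
      rcases mem_insert.1 hq with rfl | hq
      · exact key _ j hij hg
      · rw [mem_singleton.1 hq]
        exact key _ i hij.symm (by rw [add_comm]; exact hg)
    exact this

end Zeros

/-! ### Khatri-Rao powers -/

section Pow

variable {K R N n : ℕ}

theorem khatriRaoPow_col (F : Matrix (Fin K) (Fin N) ℝ) (n : ℕ) (j : Fin N) :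
    (khatriRaoPow F n).col j = symPow (F.col j) n := rfl

theorem sum_prod_mul_symPow (y : Fin n → Fin K → ℝ) (x : Fin K → ℝ) :
    ∑ k : Fin n → Fin K, (∏ p, y p (k p)) * symPow x n k = ∏ p, (x ⬝ᵥ y p) := by
  simp only [symPow, ← Finset.prod_mul_distrib, dotProduct]
  rw [Fintype.prod_sum]
  exact Finset.sum_congr rfl fun k _ => Finset.prod_congr rfl fun p _ => mul_comm _ _

/-- To isolate the `i`-th coefficient, pair the relation with a tensor product of the columns of `C`
not orthogonal to `f_i`. There are `R - (K - 1)` of them, so `n` factors suffice to use each at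
least once. Every other `f_j` is orthogonal to one of them, its zero set being different but of
equal size. -/
theorem IsNormalMatrix.fullColRank_khatriRaoPow {C : Matrix (Fin K) (Fin R) ℝ}
    {F : Matrix (Fin K) (Fin (R.choose (K - 1))) ℝ} (hF : IsNormalMatrix C F) (hC : GenPos C)
    (hK : 1 ≤ K) (hKR : K ≤ R) (hn : R - (K - 1) ≤ n) : FullColRank (khatriRaoPow F n) := by
  refine Fintype.linearIndependent_iff.2 fun g hg i => ?_
  have hcard : Fintype.card {r // r ∉ zeros C (F.col i)} ≤ Fintype.card (Fin n) := by
    rw [Fintype.card_subtype_compl]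
    simp [(isNormalMatrix_iff.1 hF).1 i, hn]
  obtain ⟨r₀, hr₀⟩ := hF.exists_ne_zero hK hKR i
  have : Nonempty {r // r ∉ zeros C (F.col i)} := ⟨⟨r₀, fun h => hr₀ (mem_zeros.1 h)⟩⟩
  obtain ⟨e⟩ := Function.Embedding.nonempty_of_card_le hcard
  let q : Fin n → {r // r ∉ zeros C (F.col i)} := Function.invFun e
  have hq : Function.Surjective q := Function.invFun_surjective e.injective
  have hsum : ∑ j, g j * ∏ p, (F.col j ⬝ᵥ C.col (q p)) = 0 := by
    have h : ∀ j, g j * ∏ p, (F.col j ⬝ᵥ C.col (q p)) =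
        ∑ k : Fin n → Fin K, (∏ p, C.col (q p) (k p)) * (g j • (khatriRaoPow F n).col j) k := by
      intro j
      rw [← sum_prod_mul_symPow, Finset.mul_sum]
      refine Finset.sum_congr rfl fun k _ => ?_
      rw [Pi.smul_apply, khatriRaoPow_col, smul_eq_mul]
      ring
    rw [Finset.sum_congr rfl fun j _ => h j, Finset.sum_comm]
    refine Finset.sum_eq_zero fun k _ => ?_
    rw [← Finset.mul_sum, ← Finset.sum_apply, hg, Pi.zero_apply, mul_zero]
  rw [Finset.sum_eq_single i] at hsum
  · refine (mul_eq_zero.1 hsum).resolve_right (Finset.prod_ne_zero_iff.2 fun p _ => ?_)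
    exact fun h => (q p).2 (mem_zeros.2 h)
  · intro j _ hji
    obtain ⟨r, hr, hr'⟩ := hF.exists_mem_notMem hC hK hKR hji
    obtain ⟨p, hp⟩ := hq ⟨r, fun h => hr' (mem_zeros.1 h)⟩
    rw [Finset.prod_eq_zero (mem_univ p), mul_zero]
    rw [hp]
    exact hr
  · simp

theorem reshapeVec_symPow (hn : 1 ≤ n) (x : Fin K → ℝ) (k : Fin K) (κ : Fin (n - 1) → Fin K) :
    reshapeVec (symPow x n) k κ = x k * symPow x (n - 1) κ := by
  obtain ⟨n, rfl⟩ : ∃ n', n = n' + 1 := ⟨n - 1, by omega⟩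
  simp only [reshapeVec, Matrix.of_apply, symPow]
  rw [Fin.prod_univ_succ]
  simp

theorem reshapeVec_khatriRaoPow_mulVec (hn : 1 ≤ n) (F : Matrix (Fin K) (Fin N) ℝ) (z : Fin N → ℝ)
    (k : Fin K) (κ : Fin (n - 1) → Fin K) :
    reshapeVec (khatriRaoPow F n *ᵥ z) k κ =
      ∑ j, z j * (F k j * symPow (F.col j) (n - 1) κ) := by
  have h : reshapeVec (khatriRaoPow F n *ᵥ z) k κ =
      ∑ j, z j * reshapeVec (symPow (F.col j) n) k κ := by
    simp only [reshapeVec, Matrix.of_apply, Matrix.mulVec, dotProduct]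
    exact Finset.sum_congr rfl fun j _ => mul_comm _ _
  rw [h]
  exact Finset.sum_congr rfl fun j _ => by rw [reshapeVec_symPow hn]; rfl

/-- Contract one factor with any `u` orthogonal to `x`: the left side vanishes, and independence of
the powers of order `n - 1` gives `f_j · u = 0` for each `j` with nonzero coefficient. Such an `f_j`
is then a multiple of `x`. -/
theorem exists_eq_smul_of_symPow_mem (hn : 1 ≤ n) {F : Matrix (Fin K) (Fin N) ℝ}
    (hF : FullColRank (khatriRaoPow F (n - 1))) (hF0 : ∀ j, F.col j ≠ 0) {x : Fin K → ℝ}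
    (hx : x ≠ 0) (h : symPow x n ∈ LinearMap.range (khatriRaoPow F n).mulVecLin) :
    ∃ (j : _) (t : ℝ), x = t • F.col j := by
  obtain ⟨z, hz⟩ := h
  rw [Matrix.mulVecLin_apply] at hz
  have hz0 : ∃ j, z j ≠ 0 := by
    by_contra! h0
    rw [show z = 0 from funext h0, Matrix.mulVec_zero] at hz
    obtain ⟨k, hk⟩ := Function.ne_iff.1 hx
    have := congrFun hz fun _ => k
    simp only [Pi.zero_apply, symPow, Finset.prod_const] at this
    exact pow_ne_zero _ hk this.symm
  obtain ⟨j, hj⟩ := hz0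
  obtain ⟨t, ht⟩ := mem_span_singleton_of_orth hx (x := F.col j) (by
    intro u hu
    have hsum : ∑ i, (z i * (F.col i ⬝ᵥ u)) • (khatriRaoPow F (n - 1)).col i = 0 := by
      ext κ
      have h1 : ∑ k, u k * reshapeVec (khatriRaoPow F n *ᵥ z) k κ = 0 := by
        rw [hz]
        simp only [reshapeVec_symPow hn, ← mul_assoc]
        rw [← Finset.sum_mul]
        have : ∑ k, u k * x k = x ⬝ᵥ u := by rw [dotProduct_comm]; rfl
        rw [this, hu, zero_mul]
      simp only [reshapeVec_khatriRaoPow_mulVec hn, Finset.mul_sum] at h1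
      rw [Finset.sum_comm] at h1
      rw [Finset.sum_apply, Pi.zero_apply, ← h1]
      refine Finset.sum_congr rfl fun i _ => ?_
      rw [Pi.smul_apply, khatriRaoPow_col, smul_eq_mul, dotProduct, Finset.mul_sum, Finset.sum_mul]
      refine Finset.sum_congr rfl fun k _ => ?_
      rw [Matrix.col_apply]
      ring
    exact (mul_eq_zero.1 (Fintype.linearIndependent_iff.1 hF _ hsum j)).resolve_left hj)
  have ht0 : t ≠ 0 := by
    rintro rfl
    exact hF0 j (by rw [ht, zero_smul])
  exact ⟨j, t⁻¹, by rw [ht, smul_smul, inv_mul_cancel₀ ht0, one_smul]⟩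

/-- All slice combinations share the outer factors, so a pencil of them is diagonalised
simultaneously. -/
theorem sliceComb_khatriRaoPow_mul (hn : 1 ≤ n) (F : Matrix (Fin K) (Fin N) ℝ)
    (X : Matrix (Fin N) (Fin N) ℝ) (u : Fin K → ℝ) :
    sliceComb (khatriRaoPow F n * X) u =
      khatriRaoPow F (n - 1) * (Matrix.diagonal (fun i => F.col i ⬝ᵥ u) * X) := by
  ext κ j
  have h : (khatriRaoPow F n * X).col j = khatriRaoPow F n *ᵥ X.col j := by
    ext k
    simp [Matrix.mul_apply, Matrix.mulVec, dotProduct]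
  simp only [sliceComb, Matrix.of_apply, h, reshapeVec_khatriRaoPow_mulVec hn, Finset.mul_sum]
  rw [Finset.sum_comm, Matrix.mul_apply]
  refine Finset.sum_congr rfl fun i _ => ?_
  rw [Matrix.diagonal_mul, dotProduct, Finset.sum_mul, Finset.mul_sum]
  refine Finset.sum_congr rfl fun k _ => ?_
  change u k * (X i j * (F k i * symPow (F.col i) (n - 1) κ)) =
    symPow (F.col i) (n - 1) κ * (F k i * u k * X i j)
  ring

end Pow

/-! ### Vectors whose contraction has low rank -/

section LowRank

variable {I J K R m l : ℕ} {T : Tensor3 I J K} {A : Matrix (Fin I) (Fin R) ℝ}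
  {B : Matrix (Fin J) (Fin R) ℝ} {C : Matrix (Fin K) (Fin R) ℝ}
  {F : Matrix (Fin K) (Fin (R.choose (K - 1))) ℝ}

/-- Every vector `f` for which the rank of `T f` is less than `m` is a multiple of a column
of `F`. -/
def LowRankIn {N : ℕ} (m : ℕ) (T : Tensor3 I J K) (F : Matrix (Fin K) (Fin N) ℝ) : Prop :=
  ∀ f, (contract T f).rank < m → ∃ (j : Fin N) (t : ℝ), f = t • F.col j

theorem symKer_eq_range (hm : m = R - K + 2) (hK : 2 ≤ K) (hKR : K ≤ R) (hC : GenPos C)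
    (hT : T = polyadic A B C) (hF : IsNormalMatrix C F)
    (hdim : finrank ℝ (symKer m l T) = R.choose (K - 1)) :
    symKer m l T = LinearMap.range (khatriRaoPow F (m + l)).mulVecLin := by
  have hfull := hF.fullColRank_khatriRaoPow hC (by omega) hKR (show R - (K - 1) ≤ m + l by omega)
  symm
  refine Submodule.eq_of_le_of_finrank_le ?_ ?_
  · rw [Matrix.range_mulVecLin, Submodule.span_le]
    rintro _ ⟨j, rfl⟩
    rw [khatriRaoPow_col]
    refine symPow_mem_symKer ?_
    rw [hT]
    refine (rank_contract_le (U := (zeros C (F.col j))ᶜ) fun r hr => ?_).trans_lt ?_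
    · exact mem_zeros.1 (by simpa using hr)
    · rw [card_compl, (isNormalMatrix_iff.1 hF).1 j, Fintype.card_fin]
      omega
  · rw [hdim, Matrix.range_mulVecLin, finrank_span_eq_card hfull, Fintype.card_fin]

theorem lowRankIn (hm : m = R - K + 2) (hK : 2 ≤ K) (hKR : K ≤ R) (hC : GenPos C)
    (hF : IsNormalMatrix C F)
    (hE : symKer m l T = LinearMap.range (khatriRaoPow F (m + l)).mulVecLin) :
    LowRankIn m T F := by
  intro f hf
  by_cases hf0 : f = 0
  · exact ⟨⟨0, Nat.choose_pos (by omega)⟩, 0, by rw [hf0, zero_smul]⟩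
  refine exists_eq_smul_of_symPow_mem (n := m + l) (by omega)
    (hF.fullColRank_khatriRaoPow hC (by omega) hKR (by omega))
    (hF.col_ne_zero (by omega) hKR) hf0 ?_
  rw [← hE]
  exact symPow_mem_symKer hf

/-- If `m` columns of `A` were dependent, every `x` orthogonal to the other `K - 2` columns of `C`
would give a contraction of rank less than `m`. Such `x` fill a space too large for the lines of
`F`. -/
theorem LowRankIn.linearIndepOn {N : ℕ} {F : Matrix (Fin K) (Fin N) ℝ} (hm : m + K = R + 2)
    (hK : 2 ≤ K) (hE : LowRankIn m (polyadic A B C) F) (s : Finset (Fin R)) (hs : s.card ≤ m) :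
    LinearIndepOn ℝ A.col (s : Set (Fin R)) := by
  obtain ⟨t, hst, ht⟩ := Finset.exists_superset_card_eq hs (by rw [Fintype.card_fin]; omega)
  refine LinearIndepOn.mono ?_ (show (s : Set (Fin R)) ⊆ t by exact_mod_cast hst)
  by_contra hA
  obtain ⟨x, hx, hx'⟩ := exists_orth_not_smul C.col (s := tᶜ)
    (by rw [card_compl, ht, Fintype.card_fin]; omega) F.col
  obtain ⟨j, a, h⟩ := hE x (by
    rw [← ht]
    exact rank_contract_lt (fun r hr => hx r (by simpa using hr)) hA)
  exact hx' j a h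

theorem LowRankIn.swap {N : ℕ} {F : Matrix (Fin K) (Fin N) ℝ}
    (hE : LowRankIn m (polyadic A B C) F) : LowRankIn m (polyadic B A C) F := by
  intro f hf
  rw [← contract_polyadic_transpose, Matrix.rank_transpose] at hf
  exact hE f hf

theorem LowRankIn.le_of_polyadic {N R' : ℕ} {F : Matrix (Fin K) (Fin N) ℝ} (hm : m + K = R + 2)
    (hK : 2 ≤ K) {A' : Matrix (Fin I) (Fin R') ℝ}
    {B' : Matrix (Fin J) (Fin R') ℝ} {C' : Matrix (Fin K) (Fin R') ℝ}
    (hE : LowRankIn m (polyadic A' B' C') F) (hm0 : 2 ≤ m) : R ≤ R' := by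
  by_contra! hlt
  -- The minimum covers `R' < K - 2`, where all terms are killed; otherwise at most `R' - (K - 2) <
  -- m` terms survive.
  obtain ⟨Q, -, hQ⟩ := exists_subset_card_eq (s := (univ : Finset (Fin R'))) (n := min (K - 2) R')
    (by simp)
  obtain ⟨x, hx, hx'⟩ := exists_orth_not_smul C'.col (s := Q) (by omega) F.col
  obtain ⟨j, a, h⟩ := hE x (by
    refine (rank_contract_le (U := Qᶜ) fun r hr => hx r (by simpa using hr)).trans_lt ?_
    rw [card_compl, hQ, Fintype.card_fin]
    omega)
  exact hx' j a h

theorem rank_contract_col (hm : m + K = R + 2) (hK : 2 ≤ K) (hF : IsNormalMatrix C F)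
    (hE : LowRankIn m (polyadic A B C) F) (j : Fin (R.choose (K - 1))) :
    (contract (polyadic A B C) (F.col j)).rank + 1 = m := by
  have hc : (zeros C (F.col j))ᶜ.card + 1 = m := by
    have h1 := (isNormalMatrix_iff.1 hF).1 j
    have h2 := card_le_univ (zeros C (F.col j))
    rw [card_compl, h1, Fintype.card_fin]
    rw [h1, Fintype.card_fin] at h2
    omega
  rw [rank_contract_eq (U := (zeros C (F.col j))ᶜ) (fun r => by simp [mem_zeros])
    (hE.linearIndepOn hm hK _ (by omega)) (hE.swap.linearIndepOn hm hK _ (by omega)), hc]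

variable {A' : Matrix (Fin I) (Fin R) ℝ} {B' : Matrix (Fin J) (Fin R) ℝ}
  {C' : Matrix (Fin K) (Fin R) ℝ}

/-- Rank `m - 1` leaves at most `K - 1` zeros for each `f_j`. Conversely, a nonzero vector
orthogonal to `K - 1` columns of `C'` has low rank, hence is a multiple of some `f_j`. So all
`(K-1)`-subsets occur, and there are as many of them as columns of `F`. -/
theorem enumSubsets_of_polyadic (hm : m + K = R + 2) (hm0 : 2 ≤ m) (hK : 2 ≤ K)
    (hE : LowRankIn m (polyadic A' B' C') F)
    (hrank : ∀ j, (contract (polyadic A' B' C') (F.col j)).rank + 1 = m) :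
    EnumSubsets (K - 1) fun j => zeros C' (F.col j) := by
  have hle : ∀ j, (zeros C' (F.col j)).card ≤ K - 1 := by
    intro j
    have h1 := rank_contract_le (A := A') (B := B') (C := C') (f := F.col j)
      (U := (zeros C' (F.col j))ᶜ) (fun r hr => mem_zeros.1 (by simpa using hr))
    rw [card_compl, Fintype.card_fin] at h1
    have := hrank j
    omega
  have hsurj : ∀ S : Finset (Fin R), S.card = K - 1 → ∃ j, zeros C' (F.col j) = S := by
    intro S hS
    obtain ⟨x, hx0, hx⟩ := exists_ne_zero_orth C'.col (s := S) (by omega)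
    obtain ⟨j, t, rfl⟩ := hE x (by
      refine (rank_contract_le (U := Sᶜ) fun r hr => hx r (by simpa using hr)).trans_lt ?_
      rw [card_compl, hS, Fintype.card_fin]
      omega)
    have ht : t ≠ 0 := by
      rintro rfl
      exact hx0 (zero_smul _ _)
    refine ⟨j, (eq_of_subset_of_card_le (fun r hr => ?_) ((hle j).trans hS.ge)).symm⟩
    rw [← zeros_smul ht]
    exact mem_zeros.2 (hx r hr)
  refine ⟨fun j => ?_, hsurj⟩
  have hsub : powersetCard (K - 1) univ ⊆ univ.image fun j => zeros C' (F.col j) := by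
    intro S hS
    obtain ⟨j, hj⟩ := hsurj S (mem_powersetCard.1 hS).2
    exact mem_image.2 ⟨j, mem_univ _, hj⟩
  have heq := eq_of_subset_of_card_le hsub (card_image_le.trans (by simp))
  have hj : zeros C' (F.col j) ∈ univ.image fun j => zeros C' (F.col j) :=
    mem_image_of_mem _ (mem_univ j)
  rw [← heq] at hj
  exact (mem_powersetCard.1 hj).2

/-- Only `m - 1` terms survive in a contraction of rank `m - 1`, so its range is the full span of
their vectors; independence of columns of `A'` or `B'` is not presupposed. -/
theorem areDirections_of_polyadic {N : ℕ} {F : Matrix (Fin K) (Fin N) ℝ} (hm : m + K = R + 2)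
    (hcard : ∀ j, (zeros C' (F.col j)).card = K - 1) (hK : 2 ≤ K)
    (hrank : ∀ j, (contract (polyadic A' B' C') (F.col j)).rank + 1 = m)
    (hA : ∀ r, A'.col r ≠ 0) (hB : ∀ r, B'.col r ≠ 0) :
    AreDirections (polyadic A' B' C') F C' A' B' := by
  intro r
  refine ⟨hA r, hB r, fun j hj => ?_⟩
  have hc : (zeros C' (F.col j))ᶜ.card + 1 = m := by
    have h2 := card_le_univ (zeros C' (F.col j))
    rw [card_compl, hcard, Fintype.card_fin]
    rw [hcard, Fintype.card_fin] at h2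
    omega
  have hr : r ∈ ((zeros C' (F.col j))ᶜ : Finset (Fin R)) := by
    rw [mem_compl, mem_zeros, dotProduct_comm]
    exact hj
  have hU : ∀ q, q ∉ (zeros C' (F.col j))ᶜ → F.col j ⬝ᵥ C'.col q = 0 := fun q hq =>
    mem_zeros.1 (by simpa using hq)
  have hrk := hrank j
  constructor
  · rw [range_contract_eq_of_card_le_rank hU (by omega)]
    exact Submodule.subset_span ⟨r, hr, rfl⟩
  · rw [contract_polyadic_transpose, range_contract_eq_of_card_le_rank hU (by
      rw [← contract_polyadic_transpose, Matrix.rank_transpose]; omega)]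
    exact Submodule.subset_span ⟨r, hr, rfl⟩

end LowRank

/-! ### The third factor matrix -/

section ThirdFactor

variable {K R : ℕ} {C C' : Matrix (Fin K) (Fin R) ℝ}
  {F : Matrix (Fin K) (Fin (R.choose (K - 1))) ℝ}

theorem isThirdFactorFrom_of_enumSubsets (hK : 2 ≤ K) (hKR : K ≤ R)
    (hg : EnumSubsets (K - 1) fun j => zeros C' (F.col j)) (hC' : ∀ r, C'.col r ≠ 0) :
    IsThirdFactorFrom F C' := by
  obtain ⟨k, rfl⟩ : ∃ k, K = k + 2 := ⟨K - 2, by omega⟩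
  refine ⟨fun r => univ.filter fun j => r ∈ zeros C' (F.col j), fun r q hrq => ?_, fun r =>
    ⟨hg.card_filter_mem r, hC' r, fun j hj => ?_⟩⟩
  · by_contra hne
    -- The sets for `r ≠ q` differ because some `(K-1)`-subset contains `r` but not `q`.
    obtain ⟨S, hS, hSc⟩ := exists_subsuperset_card_eq (n := k + 2 - 1)
      (show ({r} : Finset (Fin R)) ⊆ univ.erase q by simpa using hne)
      (by simp) (by rw [card_erase_of_mem (mem_univ _), card_univ, Fintype.card_fin]; omega)
    obtain ⟨j, hj⟩ := hg.2 S hSc.2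
    beta_reduce at hj
    have hr : j ∈ univ.filter fun j => r ∈ zeros C' (F.col j) := by
      simp only [mem_filter, mem_univ, true_and]
      rw [hj]
      exact hS (mem_singleton_self r)
    simp only at hrq
    rw [hrq] at hr
    simp only [mem_filter, mem_univ, true_and] at hr
    rw [hj] at hr
    exact (mem_erase.1 (hSc.1 hr)).1 rfl
  · rw [dotProduct_comm]
    exact mem_zeros.1 (mem_filter.1 hj).2

theorem mem_span_of_dotProduct_eq_zero {f v : Fin K → ℝ} (hC : GenPos C)
    (hf : (zeros C f).card = K - 1) (hf0 : f ≠ 0) (hv : v ⬝ᵥ f = 0) :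
    v ∈ Submodule.span ℝ (C.col '' (zeros C f : Set (Fin R))) := by
  have hle : Submodule.span ℝ (C.col '' (zeros C f : Set (Fin R))) ≤
      LinearMap.ker (dotProductBilin ℝ ℝ f) := by
    rw [Submodule.span_le]
    rintro _ ⟨r, hr, rfl⟩
    simpa using mem_zeros.1 hr
  have heq := Submodule.eq_of_le_of_finrank_le hle (by
    rw [finrank_span_image_eq (hC _ (by omega)), hf]
    have h1 := LinearMap.finrank_range_add_finrank_ker (dotProductBilin ℝ ℝ f)
    rw [finrank_fintype_fun_eq_card, Fintype.card_fin] at h1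
    have h2 : 0 < finrank ℝ (LinearMap.range (dotProductBilin ℝ ℝ f)) := by
      rw [Module.finrank_pos_iff_exists_ne_zero]
      refine ⟨⟨f ⬝ᵥ f, f, by simp⟩, fun h => hf0 (dotProduct_self_eq_zero.1 ?_)⟩
      exact congrArg Subtype.val h
    omega)
  rw [heq]
  simpa [dotProduct_comm] using hv

/-- Orthogonality to `f_j` places `v` in the span of the `K - 1` columns of `C` orthogonal to `f_j`.
If `v` were on no line through a column of `C`, the strict case of the subset count would be
violated. -/
theorem exists_smul_col_of_card_le (hC : GenPos C) (hK : 2 ≤ K) (hKR : K ≤ R)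
    (hF : IsNormalMatrix C F) {v : Fin K → ℝ} (hv : v ≠ 0) {s : Finset (Fin (R.choose (K - 1)))}
    (hs : (R - 1).choose (K - 2) ≤ s.card) (hvs : ∀ j ∈ s, v ⬝ᵥ F.col j = 0) :
    ∃ (r : Fin R) (t : ℝ), v = t • C.col r := by
  classical
  by_contra! hcon
  have hg := hF.enumSubsets hC (by omega) hKR
  let P : Finset (Fin R) → Prop := fun S => v ∈ Submodule.span ℝ (C.col '' (S : Set (Fin R)))
  obtain ⟨-, hlt⟩ := card_filter_powersetCard_le (K - 2) (univ : Finset (Fin R)) P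
    (by rw [card_univ, Fintype.card_fin]; omega)
    (by simpa [P] using hv)
    (fun S S' h hS => Submodule.span_mono (Set.image_mono (by exact_mod_cast h)) hS)
    (fun S S' _ _ hc hS hS' => mem_span_inter (hC _ (by omega)) hS hS')
  have hlt' := hlt fun r _ hr => by
    simp only [P, coe_singleton, Set.image_singleton, Submodule.mem_span_singleton] at hr
    obtain ⟨t, ht⟩ := hr
    exact hcon r t ht.symm
  rw [show K - 2 + 1 = K - 1 by omega, ← hg.card_filter P, card_univ, Fintype.card_fin] at hlt'
  have hsub : s ⊆ univ.filter fun j => P (zeros C (F.col j)) := by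
    intro j hj
    simp only [mem_filter, mem_univ, true_and]
    exact mem_span_of_dotProduct_eq_zero hC (hg.1 j) (hF.col_ne_zero (by omega) hKR j) (hvs j hj)
  have := card_le_card hsub
  omega

theorem IsThirdFactorFrom.exists_perm (hC : GenPos C) (hK : 2 ≤ K) (hKR : K ≤ R)
    (hF : IsNormalMatrix C F) (h : IsThirdFactorFrom F C') :
    ∃ (σ : Equiv.Perm (Fin R)) (γ : Fin R → ℝ), ∀ r, γ r ≠ 0 ∧ C'.col r = γ r • C.col (σ r) := by
  obtain ⟨s, hs, h⟩ := h
  choose σ γ hσ using fun r => exists_smul_col_of_card_le hC hK hKR hF (h r).2.1 (h r).1.ge (h r).2.2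
  have hγ : ∀ r, γ r ≠ 0 := by
    intro r h0
    have := hσ r
    rw [h0, zero_smul] at this
    exact (h r).2.1 this
  have hg := hF.enumSubsets hC (by omega) hKR
  -- Equal cardinalities make `s r` depend on `σ r` alone, so distinctness of the sets makes `σ`
  -- injective.
  have hsr : ∀ r, s r = univ.filter fun j => σ r ∈ zeros C (F.col j) := by
    intro r
    refine eq_of_subset_of_card_le (fun j hj => ?_) ?_
    · have h1 := (h r).2.2 j hj
      rw [hσ r, smul_dotProduct, smul_eq_mul, mul_eq_zero, dotProduct_comm] at h1
      simpa [mem_zeros] using h1.resolve_left (hγ r)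
    · rw [(h r).1]
      obtain ⟨k, rfl⟩ : ∃ k, K = k + 2 := ⟨K - 2, by omega⟩
      exact (hg.card_filter_mem (σ r)).le
  have hinj : Function.Injective σ := fun r q hrq => hs (by rw [hsr, hsr, hrq])
  exact ⟨Equiv.ofBijective σ (Finite.injective_iff_bijective.1 hinj), γ, fun r => ⟨hγ r, hσ r⟩⟩

end ThirdFactor

/-! ### The first two factor matrices -/

section Directions

variable {I J K R m : ℕ} {A A₀ : Matrix (Fin I) (Fin R) ℝ} {B B₀ : Matrix (Fin J) (Fin R) ℝ}
  {C C' : Matrix (Fin K) (Fin R) ℝ} {F : Matrix (Fin K) (Fin (R.choose (K - 1))) ℝ}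

/-- Every `(m-1)`-set `U` containing `r` is the complement of the zero set of some `f_j`, so `v`
lies in all the spans of `a_U`. -/
theorem exists_smul_of_forall_mem_range (hm : m + K = R + 2) (hm0 : 2 ≤ m) (hK : 2 ≤ K)
    (hKR : K ≤ R) (hC : GenPos C) (hF : IsNormalMatrix C F)
    (hA : ∀ s : Finset (Fin R), s.card ≤ m → LinearIndepOn ℝ A.col (s : Set (Fin R)))
    {r : Fin R} {v : Fin I → ℝ} (hv : ∀ j, F.col j ⬝ᵥ C.col r ≠ 0 →
      v ∈ LinearMap.range (contract (polyadic A B C) (F.col j)).mulVecLin) :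
    ∃ t : ℝ, v = t • A.col r := by
  refine mem_span_singleton_of_forall_mem_span (p := m - 1) (by omega)
    (fun s hs => hA s (by omega)) (by rw [Fintype.card_fin]; omega) r fun U hr hU => ?_
  obtain ⟨j, hj⟩ := (hF.enumSubsets hC (by omega) hKR).2 Uᶜ
    (by rw [card_compl, hU, Fintype.card_fin]; omega)
  beta_reduce at hj
  refine range_contract_le (B := B) (C := C) (f := F.col j) (fun q hq => ?_) (hv j fun h0 => ?_)
  · exact mem_zeros.1 (hj ▸ mem_compl.2 hq)
  · have : r ∈ Uᶜ := hj ▸ mem_zeros.2 h0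
    exact (mem_compl.1 this) hr

theorem AreDirections.exists_smul (hm : m + K = R + 2) (hm0 : 2 ≤ m) (hK : 2 ≤ K)
    (hKR : K ≤ R) (hC : GenPos C) (hF : IsNormalMatrix C F)
    (hE : LowRankIn m (polyadic A B C) F) {σ : Equiv.Perm (Fin R)} {γ : Fin R → ℝ}
    (hσ : ∀ r, γ r ≠ 0 ∧ C'.col r = γ r • C.col (σ r))
    (h : AreDirections (polyadic A B C) F C' A₀ B₀) (r : Fin R) :
    (∃ t : ℝ, t ≠ 0 ∧ A₀.col r = t • A.col (σ r)) ∧ ∃ t : ℝ, t ≠ 0 ∧ B₀.col r = t • B.col (σ r) := by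
  obtain ⟨hA, hB, h⟩ := h r
  have hne : ∀ j, F.col j ⬝ᵥ C.col (σ r) ≠ 0 → C'.col r ⬝ᵥ F.col j ≠ 0 := by
    intro j hj
    rw [(hσ r).2, smul_dotProduct, dotProduct_comm]
    exact mul_ne_zero (hσ r).1 hj
  obtain ⟨a, ha⟩ := exists_smul_of_forall_mem_range hm hm0 hK hKR hC hF
    (hE.linearIndepOn hm hK) fun j hj => (h j (hne j hj)).1
  obtain ⟨b, hb⟩ := exists_smul_of_forall_mem_range (A := B) (B := A) hm hm0 hK hKR hC hF
    (hE.swap.linearIndepOn hm hK) fun j hj => by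
      rw [← contract_polyadic_transpose]
      exact (h j (hne j hj)).2
  refine ⟨⟨a, ?_, ha⟩, ⟨b, ?_, hb⟩⟩
  · rintro rfl
    exact hA (by rw [ha, zero_smul])
  · rintro rfl
    exact hB (by rw [hb, zero_smul])

theorem areDirections_of_perm (hm : m + K = R + 2) (hK : 2 ≤ K)
    (hF : IsNormalMatrix C F) (hE : LowRankIn m (polyadic A B C) F)
    {σ : Equiv.Perm (Fin R)} {γ : Fin R → ℝ}
    (hσ : ∀ r, γ r ≠ 0 ∧ C'.col r = γ r • C.col (σ r))
    (hA : ∀ r, A.col r ≠ 0) (hB : ∀ r, B.col r ≠ 0) :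
    AreDirections (polyadic A B C) F C' (A.submatrix id σ) (B.submatrix id σ) := by
  have h := areDirections_of_polyadic hm (isNormalMatrix_iff.1 hF).1 hK
    (rank_contract_col hm hK hF hE) hA hB
  intro r
  refine ⟨hA (σ r), hB (σ r), fun j hj => (h (σ r)).2.2 j fun h0 => hj ?_⟩
  rw [(hσ r).2, smul_dotProduct, h0, smul_zero]

theorem polyadic_eq_iff (hAB : FullColRank (khatriRao A B)) (hC0 : ∀ r, C.col r ≠ 0)
    {A' : Matrix (Fin I) (Fin R) ℝ} {B' : Matrix (Fin J) (Fin R) ℝ}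
    {σ : Equiv.Perm (Fin R)} {α β γ : Fin R → ℝ}
    (hA : ∀ r, A'.col r = α r • A.col (σ r)) (hB : ∀ r, B'.col r = β r • B.col (σ r))
    (hC : ∀ r, C'.col r = γ r • C.col (σ r)) :
    polyadic A B C = polyadic A' B' C' ↔ ∀ r, α r * β r * γ r = 1 := by
  have hexp : ∀ i j k, polyadic A' B' C' i j k =
      ∑ q, (α (σ.symm q) * β (σ.symm q) * γ (σ.symm q)) * (A i q * B j q * C k q) := by
    intro i j k
    refine Fintype.sum_equiv σ _ _ fun r => ?_
    have h1 : A' i r = α r * A i (σ r) := congrFun (hA r) i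
    have h2 : B' j r = β r * B j (σ r) := congrFun (hB r) j
    have h3 : C' k r = γ r * C k (σ r) := congrFun (hC r) k
    rw [h1, h2, h3, σ.symm_apply_apply]
    ring
  constructor
  · intro h r
    -- In a slice `k` where `c_{σ r}` is nonzero, compare the coefficients of the independent `a_q ⊗
    -- b_q`.
    obtain ⟨k, hk⟩ := Function.ne_iff.1 (hC0 (σ r))
    have hli := Fintype.linearIndependent_iff.1 hAB
      (fun q => (α (σ.symm q) * β (σ.symm q) * γ (σ.symm q) - 1) * C k q) (by
        ext ⟨i, j⟩
        have h4 := congrFun (congrFun (congrFun h i) j) k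
        rw [hexp] at h4
        simp only [polyadic] at h4
        rw [← sub_eq_zero, ← Finset.sum_sub_distrib] at h4
        rw [Finset.sum_apply, Pi.zero_apply, ← neg_eq_zero, ← Finset.sum_neg_distrib, ← h4]
        refine Finset.sum_congr rfl fun q _ => ?_
        simp only [Pi.smul_apply, Matrix.col_apply, khatriRao, Matrix.of_apply, smul_eq_mul]
        ring) (σ r)
    rw [σ.symm_apply_apply] at hli
    exact sub_eq_zero.1 ((mul_eq_zero.1 hli).resolve_right hk)
  · intro h
    ext i j k
    rw [hexp]
    simp [polyadic, h]

end Directions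

/-! ### The generalized eigenvalue decomposition -/

section GEVD

variable {K R N n : ℕ} {F : Matrix (Fin K) (Fin N) ℝ}

theorem FullColRank.mulVec_injective {ι : Type*} [Fintype ι] {M : Matrix ι (Fin N) ℝ}
    (h : FullColRank M) : Function.Injective M.mulVec :=
  Matrix.mulVec_injective_iff.2 h

theorem exists_isBasisMatrix {ι : Type*} [Fintype ι] {E : Submodule ℝ (ι → ℝ)}
    (h : finrank ℝ E = N) : ∃ W : Matrix ι (Fin N) ℝ, IsBasisMatrix E W := by
  let b := finBasisOfFinrankEq ℝ E h
  refine ⟨Matrix.of fun i j => (b j : ι → ℝ) i, ?_, ?_⟩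
  · exact b.linearIndependent.map' E.subtype E.ker_subtype
  · have h1 : (Matrix.of fun i j => (b j : ι → ℝ) i).col = E.subtype ∘ b := rfl
    rw [h1, Set.range_comp, Submodule.span_image, b.span_eq, Submodule.map_subtype_top]

theorem existsUnique_eq_mul_transpose {ι : Type*} [Fintype ι] {G W : Matrix ι (Fin N) ℝ}
    (hG : FullColRank G) (hW : IsBasisMatrix (LinearMap.range G.mulVecLin) W) :
    ∃! M : Matrix (Fin N) (Fin N) ℝ, IsUnit M.det ∧ W = G * Mᵀ := by
  have hmem : ∀ j, ∃ x, G *ᵥ x = W.col j := by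
    intro j
    have : W.col j ∈ LinearMap.range G.mulVecLin :=
      hW.2 ▸ Submodule.subset_span (Set.mem_range_self j)
    simpa using this
  choose M hM using hmem
  have hWM : W = G * (Matrix.of M)ᵀ := by
    ext i j
    exact (congrFun (hM j) i).symm
  refine ⟨Matrix.of M, ⟨?_, hWM⟩, ?_⟩
  · rw [← Matrix.det_transpose, ← Matrix.isUnit_iff_isUnit_det,
      ← Matrix.mulVec_injective_iff_isUnit]
    intro x y hxy
    refine FullColRank.mulVec_injective hW.1 ?_
    rw [hWM, ← Matrix.mulVec_mulVec, ← Matrix.mulVec_mulVec, hxy]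
  · rintro M' ⟨-, hM'⟩
    ext j i
    refine congrFun (hG.mulVec_injective (a₁ := M' j) (a₂ := M j) ?_) i
    rw [hM j, hM']
    rfl

variable {X : Matrix (Fin N) (Fin N) ℝ}

theorem sliceComb_mulVec (hn : 1 ≤ n) (u : Fin K → ℝ) (y : Fin N → ℝ) :
    sliceComb (khatriRaoPow F n * X) u *ᵥ y =
      khatriRaoPow F (n - 1) *ᵥ fun i => (F.col i ⬝ᵥ u) * (X *ᵥ y) i := by
  rw [sliceComb_khatriRaoPow_mul hn, ← Matrix.mulVec_mulVec, ← Matrix.mulVec_mulVec]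
  congr 1
  ext i
  rw [Matrix.mulVec_diagonal]

/-- If `i` is in the support of `X y_j`, then `f_i · u = μ_j (f_i · v)`. As `f_i · v ≠ 0` and the
`μ_j` are distinct, the supports are disjoint; `N` nonempty disjoint subsets of `N` indices are
singletons. -/
theorem IsGEVD.exists_perm (hn : 1 ≤ n) (hF : FullColRank (khatriRaoPow F (n - 1)))
    (hX : IsUnit X.det) {u v : Fin K → ℝ} {Y : Matrix (Fin N) (Fin N) ℝ} {μ : Fin N → ℝ}
    (h : IsGEVD (khatriRaoPow F n * X) u v Y μ) :
    ∃ (τ : Equiv.Perm (Fin N)) (c : Fin N → ℝ), ∀ j, c j ≠ 0 ∧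
      X *ᵥ Y.col j = Pi.single (τ j) (c j) := by
  obtain ⟨hv, hμ, hY⟩ := h
  have hXu := (Matrix.isUnit_iff_isUnit_det X).2 hX
  have hXinj := Matrix.mulVec_injective_iff_isUnit.2 hXu
  have hXsurj := Matrix.mulVec_surjective_iff_isUnit.2 hXu
  -- A zero entry of the diagonal factor would put a nonzero vector in the kernel of `W_v`.
  have hv0 : ∀ i, F.col i ⬝ᵥ v ≠ 0 := by
    intro i h0
    obtain ⟨y, hy⟩ := hXsurj (Pi.single i 1)
    have hz : sliceComb (khatriRaoPow F n * X) v *ᵥ y = 0 := by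
      have hzero : (fun j => (F.col j ⬝ᵥ v) * (Pi.single i 1 : Fin N → ℝ) j) = 0 := by
        ext j
        by_cases hj : j = i
        · subst hj
          simp [h0]
        · simp [hj]
      rw [sliceComb_mulVec hn, hy, hzero, Matrix.mulVec_zero]
    have hy0 : y = 0 := hv.mulVec_injective (by rw [hz, Matrix.mulVec_zero])
    rw [hy0, Matrix.mulVec_zero] at hy
    simpa using congrFun hy i
  have hz0 : ∀ j, ∃ i, (X *ᵥ Y.col j) i ≠ 0 := by
    intro j
    by_contra! h0
    exact (hY j).1 (hXinj (by rw [Matrix.mulVec_zero]; exact funext h0))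
  have hsupp : ∀ j i, (X *ᵥ Y.col j) i ≠ 0 → F.col i ⬝ᵥ u = μ j * (F.col i ⬝ᵥ v) := by
    intro j i hi
    have h1 := (hY j).2
    rw [sliceComb_mulVec hn, sliceComb_mulVec hn, ← Matrix.mulVec_smul] at h1
    have h2 := congrFun (hF.mulVec_injective h1) i
    simp only [Pi.smul_apply, smul_eq_mul, ← mul_assoc] at h2
    exact mul_right_cancel₀ hi h2
  choose τ hτ using hz0
  have hμeq : ∀ i j j', F.col i ⬝ᵥ u = μ j * (F.col i ⬝ᵥ v) →
      F.col i ⬝ᵥ u = μ j' * (F.col i ⬝ᵥ v) → j = j' := fun i j j' h h' =>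
    hμ (mul_right_cancel₀ (hv0 i) (h.symm.trans h'))
  have hinj : Function.Injective τ := fun j j' hjj' =>
    hμeq (τ j) j j' (hsupp j _ (hτ j)) (by rw [hjj']; exact hsupp j' _ (hτ j'))
  have hbij := Finite.injective_iff_bijective.1 hinj
  refine ⟨Equiv.ofBijective τ hbij, fun j => (X *ᵥ Y.col j) (τ j), fun j => ⟨hτ j, ?_⟩⟩
  ext i
  by_cases hi : i = τ j
  · subst hi
    simp
  · rw [Equiv.ofBijective_apply, Pi.single_eq_of_ne hi]
    by_contra hne
    obtain ⟨j', rfl⟩ := hbij.2 i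
    exact hi (by rw [hμeq (τ j') j j' (hsupp j _ hne) (hsupp j' _ (hτ j'))])

/-- The reshaped vector is a multiple of the rank-one matrix built from `f_j` and its power, so its
column space lies on the line of `f_j`. -/
theorem reshapeVec_mulVec (hn : 1 ≤ n) {y : Fin N → ℝ} {j : Fin N} {c : ℝ}
    (hy : X *ᵥ y = Pi.single j c) (w : (Fin (n - 1) → Fin K) → ℝ) :
    reshapeVec ((khatriRaoPow F n * X) *ᵥ y) *ᵥ w =
      (c * ∑ κ, symPow (F.col j) (n - 1) κ * w κ) • F.col j := by
  ext k
  rw [← Matrix.mulVec_mulVec, hy]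
  simp only [Matrix.mulVec, dotProduct, Pi.smul_apply, smul_eq_mul, Matrix.col_apply]
  rw [Finset.mul_sum, Finset.sum_mul]
  refine Finset.sum_congr rfl fun κ _ => ?_
  have h := reshapeVec_khatriRaoPow_mulVec hn F (Pi.single j c) k κ
  rw [Finset.sum_eq_single j (fun i _ hi => by simp [hi]) (by simp), Pi.single_eq_same] at h
  change reshapeVec (khatriRaoPow F n *ᵥ Pi.single j c) k κ * w κ = _
  rw [h]
  ring

theorem isReadOff_of_single (hn : 1 ≤ n) (hF0 : ∀ j, F.col j ≠ 0) {Y : Matrix (Fin N) (Fin N) ℝ}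
    {τ : Equiv.Perm (Fin N)} {c : Fin N → ℝ}
    (hτ : ∀ j, c j ≠ 0 ∧ X *ᵥ Y.col j = Pi.single (τ j) (c j)) :
    IsReadOff (khatriRaoPow F n * X) Y (F.submatrix id τ) := by
  intro j
  refine ⟨hF0 (τ j), ?_⟩
  obtain ⟨k, hk⟩ := Function.ne_iff.1 (hF0 (τ j))
  have hs : symPow (F.col (τ j)) (n - 1) (fun _ => k) ≠ 0 := Finset.prod_ne_zero_iff.2 fun _ _ => hk
  refine ⟨Pi.single (fun _ => k) (c j * symPow (F.col (τ j)) (n - 1) (fun _ => k))⁻¹, ?_⟩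
  rw [Matrix.mulVecLin_apply, reshapeVec_mulVec hn (hτ j).2]
  simp only [Pi.single_apply, mul_ite, mul_zero, Finset.sum_ite_eq', mem_univ, if_true]
  rw [← mul_assoc, mul_inv_cancel₀ (mul_ne_zero (hτ j).1 hs), one_smul]
  rfl

theorem IsReadOff.exists_smul (hn : 1 ≤ n) {Y : Matrix (Fin N) (Fin N) ℝ}
    {F' : Matrix (Fin K) (Fin N) ℝ} {τ : Equiv.Perm (Fin N)} {c : Fin N → ℝ}
    (hτ : ∀ j, X *ᵥ Y.col j = Pi.single (τ j) (c j))
    (h : IsReadOff (khatriRaoPow F n * X) Y F') (j : Fin N) :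
    ∃ t : ℝ, t ≠ 0 ∧ F'.col j = t • F.col (τ j) := by
  obtain ⟨h0, w, hw⟩ := h j
  rw [Matrix.mulVecLin_apply, reshapeVec_mulVec hn (hτ j)] at hw
  refine ⟨_, ?_, hw.symm⟩
  intro ht
  rw [ht, zero_smul] at hw
  exact h0 hw.symm

theorem IsNormalMatrix.of_smul {C : Matrix (Fin K) (Fin R) ℝ}
    {F F' : Matrix (Fin K) (Fin (R.choose (K - 1))) ℝ} (hF : IsNormalMatrix C F)
    (τ : Equiv.Perm (Fin (R.choose (K - 1))))
    (h : ∀ j, ∃ t : ℝ, t ≠ 0 ∧ F'.col j = t • F.col (τ j)) : IsNormalMatrix C F' := by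
  rw [isNormalMatrix_iff] at hF ⊢
  constructor
  · intro j
    obtain ⟨t, ht, hj⟩ := h j
    rw [hj, zeros_smul ht, hF.1]
  · intro x hx
    obtain ⟨i, s, rfl⟩ := hF.2 x hx
    obtain ⟨t, ht, hj⟩ := h (τ.symm i)
    rw [τ.apply_symm_apply] at hj
    exact ⟨τ.symm i, s * t⁻¹, by rw [hj, smul_smul, mul_assoc, inv_mul_cancel₀ ht, mul_one]⟩

/-- The columns of `X⁻¹` are the eigenvectors, with eigenvalues `(f_j · u) / (f_j · v)`; the two
conditions say these are defined and distinct. -/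
theorem isGEVD_of_ne (hn : 1 ≤ n) (hF : FullColRank (khatriRaoPow F (n - 1)))
    (hX : IsUnit X.det) {u v : Fin K → ℝ} (hv : ∀ i, F.col i ⬝ᵥ v ≠ 0)
    (huv : ∀ i j, i ≠ j →
      (F.col i ⬝ᵥ u) * (F.col j ⬝ᵥ v) - (F.col j ⬝ᵥ u) * (F.col i ⬝ᵥ v) ≠ 0) :
    ∃ Y μ, IsGEVD (khatriRaoPow F n * X) u v Y μ := by
  have hXu := (Matrix.isUnit_iff_isUnit_det X).2 hX
  have hY : ∀ j, X *ᵥ (X⁻¹).col j = Pi.single j 1 := by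
    intro j
    rw [← Matrix.mulVec_single_one, Matrix.mulVec_mulVec, Matrix.mul_nonsing_inv _ hX,
      Matrix.one_mulVec]
  refine ⟨X⁻¹, fun j => (F.col j ⬝ᵥ u) / (F.col j ⬝ᵥ v), ?_, ?_, fun j => ⟨fun h0 => ?_, ?_⟩⟩
  · refine Matrix.mulVec_injective_iff.1 fun y y' hyy' => ?_
    rw [sliceComb_mulVec hn, sliceComb_mulVec hn] at hyy'
    refine Matrix.mulVec_injective_iff_isUnit.2 hXu (funext fun i => ?_)
    exact mul_left_cancel₀ (hv i) (congrFun (hF.mulVec_injective hyy') i)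
  · intro i j hij
    by_contra hne
    apply huv i j hne
    simp only at hij
    rw [div_eq_div_iff (hv i) (hv j)] at hij
    rw [hij, sub_self]
  · have := hY j
    rw [h0, Matrix.mulVec_zero] at this
    simpa using congrFun this j
  · rw [sliceComb_mulVec hn, sliceComb_mulVec hn, ← Matrix.mulVec_smul, hY]
    congr 1
    ext i
    by_cases hi : i = j
    · subst hi
      simp [hv i]
    · simp [hi]

theorem IsNormalMatrix.exists_polynomial {C : Matrix (Fin K) (Fin R) ℝ}
    {F : Matrix (Fin K) (Fin (R.choose (K - 1))) ℝ} (hF : IsNormalMatrix C F) (hC : GenPos C)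
    (hK : 1 ≤ K) (hKR : K ≤ R) :
    ∃ P : MvPolynomial (Fin K ⊕ Fin K) ℝ, P ≠ 0 ∧ ∀ u v : Fin K → ℝ,
      MvPolynomial.eval (Sum.elim u v) P ≠ 0 → (∀ i, F.col i ⬝ᵥ v ≠ 0) ∧ ∀ i j, i ≠ j →
        (F.col i ⬝ᵥ u) * (F.col j ⬝ᵥ v) - (F.col j ⬝ᵥ u) * (F.col i ⬝ᵥ v) ≠ 0 := by
  let p : Fin (R.choose (K - 1)) → MvPolynomial (Fin K ⊕ Fin K) ℝ :=
    fun i => ∑ k, MvPolynomial.C (F k i) * MvPolynomial.X (Sum.inl k)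
  let q : Fin (R.choose (K - 1)) → MvPolynomial (Fin K ⊕ Fin K) ℝ :=
    fun i => ∑ k, MvPolynomial.C (F k i) * MvPolynomial.X (Sum.inr k)
  have hp : ∀ i u v, MvPolynomial.eval (Sum.elim u v) (p i) = F.col i ⬝ᵥ u := by
    intro i u v
    simp [p, dotProduct]
  have hq : ∀ i u v, MvPolynomial.eval (Sum.elim u v) (q i) = F.col i ⬝ᵥ v := by
    intro i u v
    simp [q, dotProduct]
  refine ⟨(∏ i, q i) * ∏ x ∈ (univ : Finset (Fin (R.choose (K - 1)))).offDiag,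
    (p x.1 * q x.2 - p x.2 * q x.1), mul_ne_zero ?_ ?_, fun u v h => ?_⟩
  · refine Finset.prod_ne_zero_iff.2 fun i _ h0 => ?_
    obtain ⟨r, hr⟩ := hF.exists_ne_zero hK hKR i
    exact hr (by rw [← hq i 0, h0, map_zero])
  · refine Finset.prod_ne_zero_iff.2 fun x hx h0 => ?_
    obtain ⟨r, hr, hr'⟩ := hF.exists_mem_notMem hC hK hKR (mem_offDiag.1 hx).2.2
    obtain ⟨s, hs⟩ := hF.exists_ne_zero hK hKR x.1
    -- With `u = c_r` orthogonal to the first of the two columns only, the factor reduces to one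
    -- nonzero product.
    have := congrArg (MvPolynomial.eval (Sum.elim (C.col r) (C.col s))) h0
    rw [map_sub, map_mul, map_mul, hp, hp, hq, hq, hr, zero_mul, zero_sub, map_zero,
      neg_eq_zero] at this
    exact (mul_ne_zero hr' hs) this
  · rw [map_mul, map_prod, map_prod] at h
    obtain ⟨h1, h2⟩ := mul_ne_zero_iff.1 h
    refine ⟨fun i => ?_, fun i j hij => ?_⟩
    · rw [← hq i u v]
      exact Finset.prod_ne_zero_iff.1 h1 i (mem_univ i)
    · have := Finset.prod_ne_zero_iff.1 h2 (i, j) (by simp [hij])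
      rwa [map_sub, map_mul, map_mul, hp, hp, hq, hq] at this

end GEVD

/-! ### Rank and uniqueness -/

section Rank

variable {I J K R m : ℕ} {A : Matrix (Fin I) (Fin R) ℝ} {B : Matrix (Fin J) (Fin R) ℝ}
  {C : Matrix (Fin K) (Fin R) ℝ} {F : Matrix (Fin K) (Fin (R.choose (K - 1))) ℝ}

theorem FullColRank.col_ne_zero (hAB : FullColRank (khatriRao A B)) (r : Fin R) :
    A.col r ≠ 0 ∧ B.col r ≠ 0 := by
  constructor
  all_goals
    intro h0
    refine hAB.ne_zero r (funext fun p => ?_)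
  · have : A p.1 r = 0 := congrFun h0 p.1
    simp [khatriRao, this]
  · have : B p.2 r = 0 := congrFun h0 p.2
    simp [khatriRao, this]

theorem GenPos.col_ne_zero (hC : GenPos C) (hK : 1 ≤ K) (r : Fin R) : C.col r ≠ 0 := by
  have h := hC {r} (by simpa using hK)
  exact h.ne_zero (by simp)

theorem tensorRank_eq (hm : m + K = R + 2) (hm0 : 2 ≤ m) (hK : 2 ≤ K)
    (hE : LowRankIn m (polyadic A B C) F) (hPD : IsPD (polyadic A B C) A B C) :
    tensorRank (polyadic A B C) = R := by
  refine le_antisymm (Nat.sInf_le ⟨A, B, C, hPD⟩) ?_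
  obtain ⟨A', B', C', h, -⟩ := Nat.sInf_mem (s := {R : ℕ | ∃ (A' : Matrix (Fin I) (Fin R) ℝ)
    (B' : Matrix (Fin J) (Fin R) ℝ) (C' : Matrix (Fin K) (Fin R) ℝ),
      IsPD (polyadic A B C) A' B' C'}) ⟨R, A, B, C, hPD⟩
  rw [h] at hE
  exact hE.le_of_polyadic hm hK hm0

/-- Any rival decomposition satisfies the constraints of steps (d) and (e) for the same `F`, so it
inherits the conclusions proved for the procedure. -/
theorem exists_perm_of_polyadic_eq (hm : m + K = R + 2) (hm0 : 2 ≤ m) (hK : 2 ≤ K) (hKR : K ≤ R)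
    (hC : GenPos C) (hAB : FullColRank (khatriRao A B)) (hF : IsNormalMatrix C F)
    (hE : LowRankIn m (polyadic A B C) F) {A' : Matrix (Fin I) (Fin R) ℝ}
    {B' : Matrix (Fin J) (Fin R) ℝ} {C' : Matrix (Fin K) (Fin R) ℝ}
    (h : IsPD (polyadic A B C) A' B' C') :
    ∃ (σ : Equiv.Perm (Fin R)) (α β γ : Fin R → ℝ), ∀ r,
      α r * β r * γ r = 1 ∧ A'.col r = α r • A.col (σ r) ∧ B'.col r = β r • B.col (σ r) ∧
        C'.col r = γ r • C.col (σ r) := by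
  obtain ⟨h, hne⟩ := h
  have hrank := rank_contract_col hm hK hF hE
  have hE' := hE
  have hrank' := hrank
  rw [h] at hE'
  simp only [h] at hrank'
  have hg := enumSubsets_of_polyadic hm hm0 hK hE' hrank'
  obtain ⟨σ, γ, hσ⟩ := (isThirdFactorFrom_of_enumSubsets hK hKR hg
    fun r => (hne r).2.2).exists_perm hC hK hKR hF
  have hdir := areDirections_of_polyadic hm hg.1 hK hrank' (fun r => (hne r).1)
    (fun r => (hne r).2.1)
  rw [← h] at hdir
  choose hα hβ using hdir.exists_smul hm hm0 hK hKR hC hF hE hσ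
  choose α hα using hα
  choose β hβ using hβ
  have h1 := (polyadic_eq_iff hAB (hC.col_ne_zero (by omega)) (fun r => (hα r).2)
    (fun r => (hβ r).2) (fun r => (hσ r).2)).1 h
  exact ⟨σ, α, β, γ, fun r => ⟨h1 r, (hα r).2, (hβ r).2, (hσ r).2⟩⟩

theorem cpdUnique (hm : m + K = R + 2) (hm0 : 2 ≤ m) (hK : 2 ≤ K) (hKR : K ≤ R)
    (hC : GenPos C) (hAB : FullColRank (khatriRao A B)) (hF : IsNormalMatrix C F)
    (hE : LowRankIn m (polyadic A B C) F) (hrk : tensorRank (polyadic A B C) = R) :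
    CPDUnique (polyadic A B C) := by
  rintro R' A₁ A₂ B₁ B₂ C₁ C₂ ⟨h₁, hR'⟩ ⟨h₂, -⟩
  rw [hrk] at hR'
  subst hR'
  obtain ⟨σ₁, α₁, β₁, γ₁, h₁⟩ := exists_perm_of_polyadic_eq hm hm0 hK hKR hC hAB hF hE h₁
  obtain ⟨σ₂, α₂, β₂, γ₂, h₂⟩ := exists_perm_of_polyadic_eq hm hm0 hK hKR hC hAB hF hE h₂
  let τ := σ₂.trans σ₁.symm
  have hτ : ∀ r, σ₁ (τ r) = σ₂ r := fun r => by simp [τ]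
  have hne : ∀ r, α₁ r ≠ 0 ∧ β₁ r ≠ 0 ∧ γ₁ r ≠ 0 := by
    intro r
    have h := (h₁ r).1
    refine ⟨?_, ?_, ?_⟩
    all_goals
      intro h0
      rw [h0] at h
      simp at h
  refine ⟨τ, fun r => α₂ r * (α₁ (τ r))⁻¹, fun r => β₂ r * (β₁ (τ r))⁻¹,
    fun r => γ₂ r * (γ₁ (τ r))⁻¹, fun r => ⟨?_, ?_, ?_, ?_⟩⟩
  · have h := (h₁ (τ r)).1
    calc _ = (α₂ r * β₂ r * γ₂ r) * (α₁ (τ r) * β₁ (τ r) * γ₁ (τ r))⁻¹ := by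
          rw [mul_inv, mul_inv]; ring
      _ = 1 := by rw [h, (h₂ r).1]; simp
  · rw [(h₁ (τ r)).2.1, (h₂ r).2.1, hτ, smul_smul, mul_assoc, inv_mul_cancel₀ (hne _).1, mul_one]
  · rw [(h₁ (τ r)).2.2.1, (h₂ r).2.2.1, hτ, smul_smul, mul_assoc, inv_mul_cancel₀ (hne _).2.1,
      mul_one]
  · rw [(h₁ (τ r)).2.2.2, (h₂ r).2.2.2, hτ, smul_smul, mul_assoc, inv_mul_cancel₀ (hne _).2.2,
      mul_one]

theorem col_mul_diagonal (M : Matrix (Fin I) (Fin R) ℝ) (x : Fin R → ℝ) (r : Fin R) :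
    (M * Matrix.diagonal x).col r = x r • M.col r := by
  ext i
  simp [mul_comm]

theorem AreDirections.exists_scaling (hm : m + K = R + 2) (hm0 : 2 ≤ m) (hK : 2 ≤ K) (hKR : K ≤ R)
    (hC : GenPos C) (hAB : FullColRank (khatriRao A B)) (hF : IsNormalMatrix C F)
    (hE : LowRankIn m (polyadic A B C) F) (hrk : tensorRank (polyadic A B C) = R)
    {A₀ : Matrix (Fin I) (Fin R) ℝ} {B₀ : Matrix (Fin J) (Fin R) ℝ}
    {C' : Matrix (Fin K) (Fin R) ℝ} (hC' : IsThirdFactorFrom F C')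
    (h : AreDirections (polyadic A B C) F C' A₀ B₀) :
    (∃ x : Fin R → ℝ, polyadic A B C = polyadic (A₀ * Matrix.diagonal x) B₀ C') ∧
      ∀ x : Fin R → ℝ, polyadic A B C = polyadic (A₀ * Matrix.diagonal x) B₀ C' →
        IsCPD (polyadic A B C) (A₀ * Matrix.diagonal x) B₀ C' := by
  obtain ⟨σ, γ, hσ⟩ := hC'.exists_perm hC hK hKR hF
  choose hα hβ using h.exists_smul hm hm0 hK hKR hC hF hE hσ
  choose α hα using hα
  choose β hβ using hβ
  have hiff : ∀ x : Fin R → ℝ, polyadic A B C = polyadic (A₀ * Matrix.diagonal x) B₀ C' ↔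
      ∀ r, x r * α r * β r * γ r = 1 := fun x =>
    polyadic_eq_iff hAB (hC.col_ne_zero (by omega)) (α := fun r => x r * α r)
      (fun r => by rw [col_mul_diagonal, (hα r).2, smul_smul]) (fun r => (hβ r).2)
      (fun r => (hσ r).2)
  constructor
  · refine ⟨fun r => (α r * β r * γ r)⁻¹, (hiff _).2 fun r => ?_⟩
    rw [mul_assoc, mul_assoc, ← mul_assoc (α r)]
    exact inv_mul_cancel₀ (mul_ne_zero (mul_ne_zero (hα r).1 (hβ r).1) (hσ r).1)
  · refine fun x hx => ⟨⟨hx, fun r => ⟨?_, (h r).2.1, ?_⟩⟩, hrk.symm⟩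
    · rw [col_mul_diagonal]
      refine smul_ne_zero (fun h0 => ?_) (h r).1
      have := (hiff x).1 hx r
      rw [h0] at this
      simp at this
    · rw [(hσ r).2]
      exact smul_ne_zero (hσ r).1 (hC.col_ne_zero (by omega) _)

end Rank

end CPD

theorem mainTheorem1 {I J K R : ℕ} (m l : ℕ) (T : CPD.Tensor3 I J K)
    (A : Matrix (Fin I) (Fin R) ℝ) (B : Matrix (Fin J) (Fin R) ℝ) (C : Matrix (Fin K) (Fin R) ℝ)
    (hT : T = CPD.polyadic A B C)
    (hK : 2 ≤ K) (hrank : C.rank = K) (hKR : K ≤ R) (hm : m = R - K + 2)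
    (hkC : CPD.kRank C = K)
    (hAB : CPD.FullColRank (CPD.khatriRao A B))
    (hdim : Module.finrank ℝ (CPD.symKer m l T) = R.choose (K - 1)) :
    -- rank and uniqueness
    (CPD.tensorRank T = R ∧ CPD.CPDUnique T) ∧
    -- the intersection is the range of `F^{(m+l)}`
    (∃ F, CPD.IsNormalMatrix C F) ∧
    (∀ F, CPD.IsNormalMatrix C F →
      2 ≤ CPD.kRank F ∧
      CPD.FullColRank (CPD.khatriRaoPow F (m + l - 1)) ∧
      CPD.symKer m l T = LinearMap.range (CPD.khatriRaoPow F (m + l)).mulVecLin ∧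
      ∀ W, CPD.IsBasisMatrix (CPD.symKer m l T) W →
        ∃! M : Matrix (Fin (R.choose (K - 1))) (Fin (R.choose (K - 1))) ℝ,
          IsUnit M.det ∧ W = CPD.khatriRaoPow F (m + l) * Mᵀ) ∧
    -- `F` is recovered by a GEVD
    (∀ (W : Matrix (Fin (m + l) → Fin K) (Fin (R.choose (K - 1))) ℝ) (u v : Fin K → ℝ)
        (Y : Matrix (Fin (R.choose (K - 1))) (Fin (R.choose (K - 1))) ℝ)
        (μ : Fin (R.choose (K - 1)) → ℝ) (F : Matrix (Fin K) (Fin (R.choose (K - 1))) ℝ),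
      CPD.IsBasisMatrix (CPD.symKer m l T) W → CPD.IsGEVD W u v Y μ → CPD.IsReadOff W Y F →
        CPD.IsNormalMatrix C F) ∧
    -- the whole CPD is found algebraically
    CPD.FoundAlgebraically T R m l := by
  have hC := CPD.genPos_of_kRank hkC
  have hK1 : 1 ≤ K := by omega
  have hm' : m + K = R + 2 := by omega
  have hm0 : 2 ≤ m := by omega
  have hn : 1 ≤ m + l := by omega
  have hrange : ∀ F, CPD.IsNormalMatrix C F →
      CPD.symKer m l T = LinearMap.range (CPD.khatriRaoPow F (m + l)).mulVecLin :=
    fun F hF => CPD.symKer_eq_range hm hK hKR hC hT hF hdim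
  have hpow : ∀ F, CPD.IsNormalMatrix C F → CPD.FullColRank (CPD.khatriRaoPow F (m + l - 1)) :=
    fun F hF => hF.fullColRank_khatriRaoPow hC hK1 hKR (by omega)
  have hfact : ∀ F, CPD.IsNormalMatrix C F → ∀ W, CPD.IsBasisMatrix (CPD.symKer m l T) W →
      ∃! M : Matrix (Fin (R.choose (K - 1))) (Fin (R.choose (K - 1))) ℝ,
        IsUnit M.det ∧ W = CPD.khatriRaoPow F (m + l) * Mᵀ := by
    intro F hF W hW
    rw [hrange F hF] at hW
    exact CPD.existsUnique_eq_mul_transpose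
      (hF.fullColRank_khatriRaoPow hC hK1 hKR (by omega)) hW
  have hlow : ∀ F, CPD.IsNormalMatrix C F → CPD.LowRankIn m T F :=
    fun F hF => CPD.lowRankIn hm hK hKR hC hF (hrange F hF)
  obtain ⟨F₀, hF₀⟩ := hC.exists_isNormalMatrix hK1 hKR
  have hnormal : ∀ W u v Y μ F, CPD.IsBasisMatrix (CPD.symKer m l T) W →
      CPD.IsGEVD W u v Y μ → CPD.IsReadOff W Y F → CPD.IsNormalMatrix C F := by
    intro W u v Y μ F hW hY hF
    -- Every basis `W` is `F₀^{(m+l)} Mᵀ`, so the GEVD lemmas apply with `X = Mᵀ`.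
    obtain ⟨M, ⟨hM, rfl⟩, -⟩ := hfact F₀ hF₀ W hW
    rw [← Matrix.det_transpose] at hM
    obtain ⟨τ, c, hτ⟩ := hY.exists_perm hn (hpow F₀ hF₀) hM
    exact hF₀.of_smul τ (hF.exists_smul hn fun j => (hτ j).2)
  subst hT
  have hPD : CPD.IsPD (CPD.polyadic A B C) A B C :=
    ⟨rfl, fun r => ⟨(hAB.col_ne_zero r).1, (hAB.col_ne_zero r).2, hC.col_ne_zero hK1 r⟩⟩
  have hrk := CPD.tensorRank_eq hm' hm0 hK (hlow F₀ hF₀) hPD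
  refine ⟨⟨hrk, CPD.cpdUnique hm' hm0 hK hKR hC hAB hF₀ (hlow F₀ hF₀) hrk⟩, ⟨F₀, hF₀⟩,
    fun F hF => ⟨hF.two_le_kRank hC hK hKR, hpow F hF, hrange F hF, hfact F hF⟩, hnormal,
    CPD.exists_isBasisMatrix hdim, fun W hW => ⟨?_, fun u v Y μ hY => ⟨?_, fun F hF => ?_⟩⟩⟩
  · obtain ⟨P, hP, hPuv⟩ := hF₀.exists_polynomial hC hK1 hKR
    obtain ⟨M, ⟨hM, rfl⟩, -⟩ := hfact F₀ hF₀ W hW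
    rw [← Matrix.det_transpose] at hM
    exact ⟨P, hP, fun u v h =>
      CPD.isGEVD_of_ne hn (hpow F₀ hF₀) hM (hPuv u v h).1 (hPuv u v h).2⟩
  · obtain ⟨M, ⟨hM, rfl⟩, -⟩ := hfact F₀ hF₀ W hW
    rw [← Matrix.det_transpose] at hM
    obtain ⟨τ, c, hτ⟩ := hY.exists_perm hn (hpow F₀ hF₀) hM
    exact ⟨_, CPD.isReadOff_of_single hn (hF₀.col_ne_zero hK1 hKR) hτ⟩
  · have hFn := hnormal W u v Y μ F hW hY hF
    refine ⟨⟨C, CPD.isThirdFactorFrom_of_enumSubsets hK hKR (hFn.enumSubsets hC hK1 hKR)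
      (hC.col_ne_zero hK1)⟩, fun C' hC' => ⟨?_, fun A₀ B₀ hAB₀ => ?_⟩⟩
    · obtain ⟨σ, γ, hσ⟩ := hC'.exists_perm hC hK hKR hFn
      exact ⟨_, _, CPD.areDirections_of_perm hm' hK hFn (hlow F hFn) hσ
        (fun r => (hAB.col_ne_zero r).1) fun r => (hAB.col_ne_zero r).2⟩
    · exact hAB₀.exists_scaling hm' hm0 hK hKR hC hAB hFn (hlow F hFn) hrk hC'
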